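/- Let $\mathfrak g$ be the Lie algebra of a compact connected simple Lie group, i.e. a finite-dimensional simple real Lie algebra that admits an invariant inner product, and let $\mathfrak h\subset\mathfrak g$ be a Cartan subalgebra. Fix an invariant inner product on $\mathfrak g$ (for instance the one normalized so that short roots have square length $2$), and use it to give $\mathfrak h$, $\mathfrak g^*$ and $\mathfrak h^*$ their inner products $(\cdot,\cdot)$ and to regard $\mathfrak h^*$ as a subspace of $\mathfrak g^*$. Call $\beta\in\mathfrak h^*$ a real root if $\beta \ne 0$ and $\sqrt{-1}\,\beta$ is a root of $(\mathfrak g_{\mathbb C},\mathfrak h_{\mathbb C})$; let $\Phi_+$ be a set of positive real roots, $\phi_+=|\Phi_+|$, $\rho=\frac12\sum_{\alpha\in\Phi_+}\alpha$, and $$\mathcal D(\lambda)=\prod_{\alpha\in\Phi_+}\frac{(\lambda,\alpha)}{(\rho,\alpha)}\qquad(\lambda\in\mathfrak h^*).$$ Identify $S(\mathfrak g)$ and $S(\mathfrak h)$ with the algebras of polynomial functions on $\mathfrak g^*$ and $\mathfrak h^*$, let $\mathcal P:S(\mathfrak g)\to S(\mathfrak h)$ be restriction of functions to $\mathfrak h^*$,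 and let $\Delta_{\mathfrak g^*}$, $\Delta_{\mathfrak h^*}$ be the Laplacians $\sum_i \partial^2/\partial x_i^2$ on $S(\mathfrak g)$, $S(\mathfrak h)$ with respect to orthonormal coordinates. Then $\Delta_{\mathfrak h^*}^{\phi_+}(\mathcal D^2)$ is a scalar, the real number $$c_{\mathfrak g}=\frac{1}{\phi_+!}\,\Delta_{\mathfrak h^*}^{\phi_+}(\mathcal D^2)$$ is nonzero, and for every $d\ge 0$ and every homogeneous polynomial $g\in S(\mathfrak g)^{\mathfrak g}$ of degree $2d$, both sides of the following identity are scalars and $$\frac{c_{\mathfrak g}}{d!}\,\Delta_{\mathfrak g^*}^{d}(g)=\frac{1}{(d+\phi_+)!}\,\Delta_{\mathfrak h^*}^{d+\phi_+}\big(\mathcal D^2\,\mathcal P(g)\big).$$ -/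

import Mathlib

open scoped TensorProduct

noncomputable section

namespace CompactLie

/-! ### Symmetric algebras: derivations, Laplacian, evaluation -/

section Sym

variable {V : Type*} [AddCommGroup V] [Module ℝ V]

/-- Auxiliary algebra homomorphism `p ↦ p + D p · ε` into the dual numbers over `S(V)`, where `D` is
the derivation extending `f`. -/
def dualNumberLift (f : V →ₗ[ℝ] SymmetricAlgebra ℝ V) :
    SymmetricAlgebra ℝ V →ₐ[ℝ] TrivSqZeroExt (SymmetricAlgebra ℝ V) (SymmetricAlgebra ℝ V) :=
  SymmetricAlgebra.lift
    ((TrivSqZeroExt.inlAlgHom ℝ (SymmetricAlgebra ℝ V) (SymmetricAlgebra ℝ V)).toLinearMap ∘ₗ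
        SymmetricAlgebra.ι ℝ V +
      (TrivSqZeroExt.inrHom (SymmetricAlgebra ℝ V) (SymmetricAlgebra ℝ V)).restrictScalars ℝ ∘ₗ f)

theorem fst_dualNumberLift (f : V →ₗ[ℝ] SymmetricAlgebra ℝ V) (p : SymmetricAlgebra ℝ V) :
    (dualNumberLift f p).fst = p := by
  have h : (TrivSqZeroExt.fstHom ℝ (SymmetricAlgebra ℝ V) (SymmetricAlgebra ℝ V)).comp
      (dualNumberLift f) = AlgHom.id ℝ _ := by
    apply SymmetricAlgebra.algHom_ext
    ext v
    simp [dualNumberLift]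
  exact DFunLike.congr_fun h p

/-- The unique derivation of `S(V)` that extends a linear map `f : V → S(V)`. -/
def extendDerivation (f : V →ₗ[ℝ] SymmetricAlgebra ℝ V) :
    Derivation ℝ (SymmetricAlgebra ℝ V) (SymmetricAlgebra ℝ V) :=
  Derivation.mk'
    ((TrivSqZeroExt.sndHom (SymmetricAlgebra ℝ V) (SymmetricAlgebra ℝ V)).restrictScalars ℝ ∘ₗ
      (dualNumberLift f).toLinearMap)
    (fun a b => by
      simp [fst_dualNumberLift, TrivSqZeroExt.snd_mul, mul_comm])

@[simp] theorem extendDerivation_ι (f : V →ₗ[ℝ] SymmetricAlgebra ℝ V) (v : V) :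
    extendDerivation f (SymmetricAlgebra.ι ℝ V v) = f v := by
  simp [extendDerivation, dualNumberLift]

/-- The directional derivative `∂_ξ` on `S(V) = P(V*)` for `ξ ∈ V*`: the derivation with
`∂_ξ v = ξ(v)` for `v ∈ V`. -/
def partialDeriv (ξ : Module.Dual ℝ V) :
    Derivation ℝ (SymmetricAlgebra ℝ V) (SymmetricAlgebra ℝ V) :=
  extendDerivation ((Algebra.linearMap ℝ (SymmetricAlgebra ℝ V)) ∘ₗ ξ)

/-- The Laplacian `∑ i, ∂²/∂x_i²` on `S(V) = P(V*)`, where the coordinate functions `x_i` on `V*` are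
the members of the basis `e` of `V`. It is used below for orthonormal bases only. -/
def laplacian {ι : Type*} [Fintype ι] (e : Module.Basis ι ℝ V) :
    Module.End ℝ (SymmetricAlgebra ℝ V) :=
  ∑ i, ((partialDeriv (e.coord i)).toLinearMap ∘ₗ (partialDeriv (e.coord i)).toLinearMap)

/-- The value at `ξ ∈ V*` of an element of `S(V)`, seen as a polynomial function on `V*`. -/
def evalAt (ξ : Module.Dual ℝ V) : SymmetricAlgebra ℝ V →ₐ[ℝ] ℝ :=
  SymmetricAlgebra.lift ξ

/-- Homogeneous elements of degree `n` of `S(V)`: linear combinations of products of `n` vectors. -/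
def IsHomogeneousOfDegree (n : ℕ) (p : SymmetricAlgebra ℝ V) : Prop :=
  p ∈ (LinearMap.range (SymmetricAlgebra.ι ℝ V)) ^ n

/-- `e` is orthonormal for the bilinear form `B`. -/
def IsOrthonormalBasis {ι : Type*} (B : LinearMap.BilinForm ℝ V) (e : Module.Basis ι ℝ V) : Prop :=
  (∀ i, B (e i) (e i) = 1) ∧ ∀ i j, i ≠ j → B (e i) (e j) = 0

end Sym

/-! ### Compact Lie algebras -/

variable {g : Type*} [LieRing g] [LieAlgebra ℝ g]

/-- An invariant inner product on a real Lie algebra: a symmetric positive definite bilinear form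
with `(⁅x, y⁆, z) = - (y, ⁅x, z⁆)`. -/
structure InvariantInnerProduct (g : Type*) [LieRing g] [LieAlgebra ℝ g] where
  form : LinearMap.BilinForm ℝ g
  symm : ∀ x y, form x y = form y x
  pos : ∀ x, x ≠ 0 → 0 < form x x
  invariant : form.lieInvariant g

/-- An element of `S(g)` lies in `S(g)^g`: it is killed, for every `x ∈ g`, by the derivation of
`S(g)` that extends `ad x`. -/
def IsInvariant (p : SymmetricAlgebra ℝ g) : Prop :=
  ∀ x : g, extendDerivation (SymmetricAlgebra.ι ℝ g ∘ₗ (LieAlgebra.ad ℝ g x)) p = 0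

/-- The real roots of `g` with respect to `h`: the nonzero `β ∈ h*` such that `√-1 β` is a root of
the complexified pair. -/
def realRoots (h : LieSubalgebra ℝ g) : Set (Module.Dual ℝ h) :=
  {β | β ≠ 0 ∧ ∃ z : ℂ ⊗[ℝ] g, z ≠ 0 ∧
    ∀ x : h, ⁅(1 : ℂ) ⊗ₜ[ℝ] (x : g), z⁆ = (Complex.I * (β x : ℂ)) • z}

/-- `P` is a set of positive real roots: the real roots that are positive at some regular `x ∈ h`. -/
def IsPositiveSystem (h : LieSubalgebra ℝ g) (P : Finset (Module.Dual ℝ h)) : Prop :=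
  ∃ x : h, (∀ β ∈ realRoots h, β x ≠ 0) ∧ ∀ β, β ∈ P ↔ β ∈ realRoots h ∧ 0 < β x

/-- The half-sum of positive roots. -/
def rho {h : LieSubalgebra ℝ g} (P : Finset (Module.Dual ℝ h)) : Module.Dual ℝ h :=
  (1 / 2 : ℝ) • ∑ α ∈ P, α

namespace InvariantInnerProduct

variable (B : InvariantInnerProduct g) (h : LieSubalgebra ℝ g)

/-- The inner product of `g` restricted to `h`. -/
def restrict : LinearMap.BilinForm ℝ h :=
  B.form.compl₁₂ (h.incl : h →ₗ[ℝ] g) (h.incl : h →ₗ[ℝ] g)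

@[simp] theorem restrict_apply (x y : h) : B.restrict h x y = B.form x y := rfl

theorem restrict_nondegenerate : (B.restrict h).Nondegenerate := by
  have key : ∀ x : h, B.restrict h x x = 0 → x = 0 := by
    intro x hx
    by_contra hne
    have := B.pos (x : g) (by simpa using hne)
    rw [restrict_apply] at hx
    linarith
  exact ⟨fun x hx => key x (hx x), fun x hx => key x (hx x)⟩

variable [FiniteDimensional ℝ g]

/-- The identification `h* ≃ h` given by the inner product: `(dualVec α, x) = α x`. -/
def dualVec : Module.Dual ℝ h ≃ₗ[ℝ] h :=
  (LinearMap.BilinForm.toDual (B.restrict h) (B.restrict_nondegenerate h)).symm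

theorem form_dualVec (α : Module.Dual ℝ h) (x : h) : B.form (B.dualVec h α) x = α x := by
  have := LinearMap.BilinForm.apply_toDual_symm_apply (hB := B.restrict_nondegenerate h) α x
  exact this

/-- The induced inner product on `h*`. -/
def dualInner (α β : Module.Dual ℝ h) : ℝ := B.form (B.dualVec h α) (B.dualVec h β)

/-- The embedding `h* → g*` given by the inner product: a functional on `h` is extended by zero on
the orthogonal complement of `h`. -/
def dualIncl (ξ : Module.Dual ℝ h) : Module.Dual ℝ g := B.form (B.dualVec h ξ)

/-- The restriction map `S(g) = P(g*) → P(h*) = S(h)` along `h* ⊂ g*`; on generators it is the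
orthogonal projection `g → h`. -/
def restriction : SymmetricAlgebra ℝ g →ₐ[ℝ] SymmetricAlgebra ℝ h :=
  SymmetricAlgebra.lift (SymmetricAlgebra.ι ℝ h ∘ₗ (B.dualVec h).toLinearMap ∘ₗ
    B.form.compl₂ (h.incl : h →ₗ[ℝ] g))

theorem evalAt_restriction (ξ : Module.Dual ℝ h) (p : SymmetricAlgebra ℝ g) :
    evalAt ξ (B.restriction h p) = evalAt (B.dualIncl h ξ) p := by
  have H : (evalAt ξ).comp (B.restriction h) = evalAt (B.dualIncl h ξ) := by
    apply SymmetricAlgebra.algHom_ext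
    ext v
    have h1 : ∀ y : h, ξ y = B.form (B.dualVec h ξ) y := fun y => (B.form_dualVec h ξ y).symm
    change evalAt ξ (B.restriction h (SymmetricAlgebra.ι ℝ g v)) =
      evalAt (B.dualIncl h ξ) (SymmetricAlgebra.ι ℝ g v)
    rw [evalAt, restriction, evalAt, SymmetricAlgebra.lift_ι_apply, SymmetricAlgebra.lift_ι_apply]
    change SymmetricAlgebra.lift ξ (SymmetricAlgebra.ι ℝ h (B.dualVec h
      (B.form.compl₂ (h.incl : h →ₗ[ℝ] g) v))) = _
    rw [SymmetricAlgebra.lift_ι_apply, h1, B.symm, form_dualVec, dualIncl, B.symm]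
    rfl
  exact DFunLike.congr_fun H p

/-- The function `λ ↦ ∏_{α ∈ P} (λ, α) / (ρ, α)` on `h*`, as an element of `S(h)`; the linear
function `(·, α)` on `h*` is the vector `dualVec α` of `h`. -/
def weylD (P : Finset (Module.Dual ℝ h)) : SymmetricAlgebra ℝ h :=
  ∏ α ∈ P, (B.dualInner h (rho P) α)⁻¹ • SymmetricAlgebra.ι ℝ h (B.dualVec h α)

theorem evalAt_weylD (P : Finset (Module.Dual ℝ h)) (ξ : Module.Dual ℝ h) :
    evalAt ξ (B.weylD h P) = ∏ α ∈ P, B.dualInner h ξ α / B.dualInner h (rho P) α := by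
  simp only [weylD, map_prod, map_smul, evalAt, SymmetricAlgebra.lift_ι_apply]
  refine Finset.prod_congr rfl fun α _ => ?_
  rw [← B.form_dualVec h ξ, smul_eq_mul, div_eq_inv_mul, dualInner, dualInner]

end InvariantInnerProduct

end CompactLie

end

/-! Let π be the product of the positive roots, so that D = kπ with k ≠ 0, and write φ for the
number of positive roots. The identity combines three facts.

Harmonicity. The Laplacian on S(h) commutes with the root reflections, and each of these sends π to
-π. Hence Δπ is also anti-invariant, so it is divisible by every positive root. These are pairwise
non-proportional linear forms, so π divides Δπ, and Δπ = 0 for degree reasons.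

Radial part. For invariant p, Δ_h(π P(p)) = π P(Δ_g p). Each positive root α has a real root plane
spanned by orthonormal u, v with [x, u] = α(x)v, [x, v] = -α(x)u and [u, v] = t_α. Invariance under
u turns the second derivative of p along v, restricted to h*, into α⁻¹ ∂_α P(p), and likewise with u
and v exchanged. Summing over the planes gives P(Δ_g p) = Δ_h P(p) + 2 Σ α⁻¹ ∂_α P(p); multiplied by
π, the last sum is the cross term of Δ_h(π P(p)), and Δπ = 0 removes the remaining term. Iterating,
Δ_h^d(D P(p)) = aD, where a is the scalar Δ_g^d p.

Products with a harmonic factor. If p is harmonic of degree k and q has degree k + 2d, then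
Δ^(k+d)(pq) = C(k+d, k) Δ^k(p Δ^d q). Taking p = D and q = D P(g) gives Δ^(φ+d)(D² P(g)) = C(φ+d, φ)
a Δ^φ(D²), which is the claim after division by (φ+d)!. The constant is nonzero because Δ^k(p²) > 0
for every nonzero harmonic p of degree k.

The root-theoretic input (one-dimensional root spaces, reducedness, stability under reflections)
comes from the complexified pair: the invariant inner product and the trivial centre make the
Killing form nondegenerate, and nondegeneracy survives complexification. -/

noncomputable section

namespace CompactLie

open SymmetricAlgebra (ι)

/-! ### Differential calculus on S(V) -/

section Calculus

variable {V : Type*} [AddCommGroup V] [Module ℝ V]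

/-- Two linear maps on `S(V)` that satisfy the Leibniz rule along the same algebra homomorphism
agree when they agree on `V`. -/
theorem leibniz_ext {A : Type*} [CommRing A] [Algebra ℝ A] (R : SymmetricAlgebra ℝ V →ₐ[ℝ] A)
    {F G : SymmetricAlgebra ℝ V →ₗ[ℝ] A}
    (hF : ∀ a b, F (a * b) = R a * F b + R b * F a)
    (hG : ∀ a b, G (a * b) = R a * G b + R b * G a)
    (h : ∀ v, F (ι ℝ V v) = G (ι ℝ V v)) : F = G := by
  have key : ∀ {F : SymmetricAlgebra ℝ V →ₗ[ℝ] A},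
      (∀ a b, F (a * b) = R a * F b + R b * F a) → F 1 = 0 := by
    intro F hF
    have := hF 1 1
    simpa using this
  ext p
  induction p using SymmetricAlgebra.induction with
  | algebraMap r =>
    rw [Algebra.algebraMap_eq_smul_one, map_smul, map_smul, key hF, key hG]
  | ι x => exact h x
  | mul a b ha hb => rw [hF, hG, ha, hb]
  | add a b ha hb => rw [map_add, map_add, ha, hb]

theorem derivation_ext {D₁ D₂ : Derivation ℝ (SymmetricAlgebra ℝ V) (SymmetricAlgebra ℝ V)}
    (h : ∀ v, D₁ (ι ℝ V v) = D₂ (ι ℝ V v)) : D₁ = D₂ := by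
  have : D₁.toLinearMap = D₂.toLinearMap :=
    leibniz_ext (AlgHom.id ℝ _) (fun a b => by simp) (fun a b => by simp) h
  ext p
  exact LinearMap.congr_fun this p

theorem derivation_sum_apply {κ : Type*} (s : Finset κ)
    (D : κ → Derivation ℝ (SymmetricAlgebra ℝ V) (SymmetricAlgebra ℝ V))
    (p : SymmetricAlgebra ℝ V) : (∑ i ∈ s, D i) p = ∑ i ∈ s, D i p := by
  classical
  induction s using Finset.induction_on with
  | empty => simp
  | insert a s ha ih => rw [Finset.sum_insert ha, Finset.sum_insert ha, Derivation.add_apply, ih]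

@[simp] theorem partialDeriv_ι (ξ : Module.Dual ℝ V) (v : V) :
    partialDeriv ξ (ι ℝ V v) = algebraMap ℝ _ (ξ v) := by
  simp [partialDeriv]

theorem partialDeriv_add (ξ η : Module.Dual ℝ V) :
    partialDeriv (ξ + η) = partialDeriv ξ + partialDeriv η :=
  derivation_ext fun v => by simp

theorem partialDeriv_smul (a : ℝ) (ξ : Module.Dual ℝ V) :
    partialDeriv (a • ξ) = a • partialDeriv ξ :=
  derivation_ext fun v => by simp [Algebra.smul_def]

/-- `ξ ↦ ∂_ξ` as a linear map. -/
def partialDerivHom : Module.Dual ℝ V →ₗ[ℝ]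
    Derivation ℝ (SymmetricAlgebra ℝ V) (SymmetricAlgebra ℝ V) where
  toFun := partialDeriv
  map_add' := partialDeriv_add
  map_smul' := partialDeriv_smul

theorem partialDerivHom_apply (ξ : Module.Dual ℝ V) : partialDerivHom ξ = partialDeriv ξ := rfl

theorem partialDeriv_sum_smul {κ : Type*} (s : Finset κ) (a : κ → ℝ) (ξ : κ → Module.Dual ℝ V)
    (p : SymmetricAlgebra ℝ V) :
    partialDeriv (∑ i ∈ s, a i • ξ i) p = ∑ i ∈ s, a i • partialDeriv (ξ i) p := by
  have := congrArg (fun D => D p) (map_sum (partialDerivHom (V := V)) (fun i => a i • ξ i) s)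
  simpa only [map_smul, partialDerivHom_apply, derivation_sum_apply,
    Derivation.smul_apply] using this

/-- A commutator of derivations is a derivation, so commutation relations need checking on V only.
-/
theorem lie_derivation_ext {D₁ D₂ D₃ : Derivation ℝ (SymmetricAlgebra ℝ V) (SymmetricAlgebra ℝ V)}
    (h : ∀ v, D₁ (D₂ (ι ℝ V v)) - D₂ (D₁ (ι ℝ V v)) = D₃ (ι ℝ V v)) (p : SymmetricAlgebra ℝ V) :
    D₁ (D₂ p) = D₂ (D₁ p) + D₃ p := by
  have : ⁅D₁, D₂⁆ = D₃ := derivation_ext fun v => by rw [Derivation.commutator_apply, h]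
  rw [← this, Derivation.commutator_apply]
  ring

theorem partialDeriv_comm (ξ η : Module.Dual ℝ V) (p : SymmetricAlgebra ℝ V) :
    partialDeriv ξ (partialDeriv η p) = partialDeriv η (partialDeriv ξ p) := by
  have := lie_derivation_ext (D₁ := partialDeriv ξ) (D₂ := partialDeriv η) (D₃ := 0)
    (fun v => by simp) p
  simpa using this

section Laplacian

variable {κ : Type*} [Fintype κ] (e : Module.Basis κ ℝ V)

theorem laplacian_apply (p : SymmetricAlgebra ℝ V) :
    laplacian e p = ∑ i, partialDeriv (e.coord i) (partialDeriv (e.coord i) p) := by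
  simp [laplacian]

theorem laplacian_mul (p q : SymmetricAlgebra ℝ V) :
    laplacian e (p * q) = laplacian e p * q +
      2 * ∑ i, partialDeriv (e.coord i) p * partialDeriv (e.coord i) q + p * laplacian e q := by
  simp only [laplacian_apply, Finset.sum_mul, Finset.mul_sum, ← Finset.sum_add_distrib]
  refine Finset.sum_congr rfl fun i _ => ?_
  simp only [Derivation.leibniz, map_add, smul_eq_mul]
  ring

theorem laplacian_partialDeriv (ξ : Module.Dual ℝ V) (p : SymmetricAlgebra ℝ V) :
    laplacian e (partialDeriv ξ p) = partialDeriv ξ (laplacian e p) := by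
  simp only [laplacian_apply, map_sum]
  refine Finset.sum_congr rfl fun i _ => ?_
  rw [partialDeriv_comm _ ξ, partialDeriv_comm _ ξ]

theorem laplacian_pow_partialDeriv (d : ℕ) (ξ : Module.Dual ℝ V) (p : SymmetricAlgebra ℝ V) :
    (laplacian e ^ d) (partialDeriv ξ p) = partialDeriv ξ ((laplacian e ^ d) p) := by
  induction d with
  | zero => simp
  | succ d ih => rw [pow_succ', Module.End.mul_apply, ih, laplacian_partialDeriv,
      Module.End.mul_apply]

end Laplacian

/-! ### Homogeneous elements and Euler's identity -/

section Homogeneous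

theorem IsHomogeneousOfDegree.mul {m n : ℕ} {p q : SymmetricAlgebra ℝ V}
    (hp : IsHomogeneousOfDegree m p) (hq : IsHomogeneousOfDegree n q) :
    IsHomogeneousOfDegree (m + n) (p * q) := by
  unfold IsHomogeneousOfDegree at *
  rw [pow_add]
  exact Submodule.mul_mem_mul hp hq

theorem isHomogeneousOfDegree_ι (v : V) : IsHomogeneousOfDegree 1 (ι ℝ V v) := by
  unfold IsHomogeneousOfDegree
  rw [pow_one]
  exact ⟨v, rfl⟩

theorem isHomogeneousOfDegree_zero_iff {p : SymmetricAlgebra ℝ V} :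
    IsHomogeneousOfDegree 0 p ↔ ∃ a : ℝ, algebraMap ℝ _ a = p := by
  unfold IsHomogeneousOfDegree
  rw [pow_zero, Submodule.mem_one]

theorem isHomogeneousOfDegree_prod {κ : Type*} (s : Finset κ) (v : κ → V) :
    IsHomogeneousOfDegree s.card (∏ i ∈ s, ι ℝ V (v i)) := by
  classical
  induction s using Finset.induction_on with
  | empty => exact isHomogeneousOfDegree_zero_iff.2 ⟨1, by simp⟩
  | insert a s ha ih =>
    rw [Finset.prod_insert ha, Finset.card_insert_of_notMem ha, add_comm]
    exact (isHomogeneousOfDegree_ι _).mul ih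

theorem IsHomogeneousOfDegree.induction {n : ℕ} {p : SymmetricAlgebra ℝ V}
    (hp : IsHomogeneousOfDegree (n + 1) p) {C : SymmetricAlgebra ℝ V → Prop}
    (mul : ∀ a v, IsHomogeneousOfDegree n a → C (a * ι ℝ V v))
    (add : ∀ a b, C a → C b → C (a + b)) : C p := by
  unfold IsHomogeneousOfDegree at hp
  rw [pow_succ] at hp
  refine Submodule.mul_induction_on hp ?_ add
  rintro a ha _ ⟨v, rfl⟩
  exact mul a v ha

theorem IsHomogeneousOfDegree.partialDeriv_zero {p : SymmetricAlgebra ℝ V}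
    (hp : IsHomogeneousOfDegree 0 p) (ξ : Module.Dual ℝ V) : partialDeriv ξ p = 0 := by
  obtain ⟨a, rfl⟩ := isHomogeneousOfDegree_zero_iff.1 hp
  simp

theorem IsHomogeneousOfDegree.add {n : ℕ} {p q : SymmetricAlgebra ℝ V}
    (hp : IsHomogeneousOfDegree n p) (hq : IsHomogeneousOfDegree n q) :
    IsHomogeneousOfDegree n (p + q) :=
  Submodule.add_mem _ hp hq

theorem IsHomogeneousOfDegree.smul {n : ℕ} {p : SymmetricAlgebra ℝ V}
    (hp : IsHomogeneousOfDegree n p) (a : ℝ) : IsHomogeneousOfDegree n (a • p) :=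
  Submodule.smul_mem _ a hp

theorem IsHomogeneousOfDegree.partialDeriv {n : ℕ} {p : SymmetricAlgebra ℝ V}
    (hp : IsHomogeneousOfDegree (n + 1) p) (ξ : Module.Dual ℝ V) :
    IsHomogeneousOfDegree n (partialDeriv ξ p) := by
  induction n generalizing p with
  | zero =>
    refine hp.induction (C := fun p => IsHomogeneousOfDegree _ (CompactLie.partialDeriv ξ p))
      (fun a v ha => ?_) fun a b ha hb => ?_
    · obtain ⟨r, rfl⟩ := isHomogeneousOfDegree_zero_iff.1 ha
      exact isHomogeneousOfDegree_zero_iff.2 ⟨r * ξ v, by simp⟩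
    · rw [map_add]; exact ha.add hb
  | succ n ih =>
    refine hp.induction (C := fun p => IsHomogeneousOfDegree _ (CompactLie.partialDeriv ξ p))
      (fun a v ha => ?_) fun a b ha hb => ?_
    · rw [Derivation.leibniz, partialDeriv_ι, smul_eq_mul, smul_eq_mul, mul_comm a,
        ← Algebra.smul_def, mul_comm]
      exact (ha.smul _).add ((ih ha).mul (isHomogeneousOfDegree_ι v))
    · rw [map_add]; exact ha.add hb

theorem IsHomogeneousOfDegree.sum {n : ℕ} {κ : Type*} (s : Finset κ)
    {p : κ → SymmetricAlgebra ℝ V} (hp : ∀ i ∈ s, IsHomogeneousOfDegree n (p i)) :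
    IsHomogeneousOfDegree n (∑ i ∈ s, p i) :=
  Submodule.sum_mem _ hp

variable {κ : Type*} [Fintype κ] (e : Module.Basis κ ℝ V)

theorem IsHomogeneousOfDegree.laplacian {n : ℕ} {p : SymmetricAlgebra ℝ V}
    (hp : IsHomogeneousOfDegree (n + 2) p) : IsHomogeneousOfDegree n (laplacian e p) := by
  rw [laplacian_apply]
  exact .sum _ fun i _ => (IsHomogeneousOfDegree.partialDeriv hp _).partialDeriv _

theorem IsHomogeneousOfDegree.laplacian_eq_zero {n : ℕ} (hn : n < 2) {p : SymmetricAlgebra ℝ V}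
    (hp : IsHomogeneousOfDegree n p) : CompactLie.laplacian e p = 0 := by
  rw [laplacian_apply]
  refine Finset.sum_eq_zero fun i _ => ?_
  interval_cases n
  · rw [hp.partialDeriv_zero, map_zero]
  · exact (hp.partialDeriv _).partialDeriv_zero _

theorem IsHomogeneousOfDegree.laplacian_pow {n : ℕ} (d : ℕ) {p : SymmetricAlgebra ℝ V}
    (hp : IsHomogeneousOfDegree (n + 2 * d) p) :
    IsHomogeneousOfDegree n ((CompactLie.laplacian e ^ d) p) := by
  induction d generalizing p with
  | zero => simpa using hp
  | succ d ih =>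
    rw [pow_succ, Module.End.mul_apply]
    exact ih (IsHomogeneousOfDegree.laplacian e (n := n + 2 * d) hp)

/-- Euler's identity. -/
theorem IsHomogeneousOfDegree.euler {n : ℕ} {p : SymmetricAlgebra ℝ V}
    (hp : IsHomogeneousOfDegree n p) :
    ∑ i, ι ℝ V (e i) * CompactLie.partialDeriv (e.coord i) p = (n : ℝ) • p := by
  let E : Derivation ℝ (SymmetricAlgebra ℝ V) (SymmetricAlgebra ℝ V) :=
    ∑ i, ι ℝ V (e i) • CompactLie.partialDeriv (e.coord i)
  have hE : ∀ p, E p = ∑ i, ι ℝ V (e i) * CompactLie.partialDeriv (e.coord i) p := fun p => by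
    simp [E, derivation_sum_apply]
  have hι : ∀ v, E (ι ℝ V v) = ι ℝ V v := fun v => by
    rw [hE]
    conv_rhs => rw [← e.sum_repr v, map_sum]
    refine Finset.sum_congr rfl fun i _ => ?_
    rw [partialDeriv_ι, map_smul, Algebra.smul_def, mul_comm]
    rfl
  rw [← hE]
  induction n generalizing p with
  | zero =>
    obtain ⟨a, rfl⟩ := isHomogeneousOfDegree_zero_iff.1 hp
    simp
  | succ n ih =>
    refine hp.induction (C := fun p => E p = ((n + 1 : ℕ) : ℝ) • p)
      (fun a v ha => ?_) fun a b ha hb => ?_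
    · rw [Derivation.leibniz, hι, ih ha]
      simp only [smul_eq_mul, Algebra.smul_def, Nat.cast_add, map_add, Nat.cast_one, map_one]
      ring
    · rw [map_add, ha, hb, smul_add]

end Homogeneous

/-! ### Powers of the Laplacian on products with a harmonic factor -/

section Harmonic

variable {κ : Type*} [Fintype κ] (e : Module.Basis κ ℝ V)

theorem laplacian_mul_of_harmonic {p : SymmetricAlgebra ℝ V} (hp : laplacian e p = 0)
    (q : SymmetricAlgebra ℝ V) :
    laplacian e (p * q) =
      (2 : ℝ) • ∑ i, partialDeriv (e.coord i) p * partialDeriv (e.coord i) q +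
        p * laplacian e q := by
  rw [laplacian_mul, hp, zero_mul, zero_add, Algebra.smul_def, map_ofNat]

/-- `Δ^N (p q) = 0` for `p` harmonic of degree larger than that of `q`. -/
theorem laplacian_pow_mul_eq_zero (N : ℕ) {k r : ℕ} {p q : SymmetricAlgebra ℝ V}
    (hp : IsHomogeneousOfDegree k p) (hp0 : laplacian e p = 0)
    (hq : IsHomogeneousOfDegree r q) (hrk : r < k) (hN : k + r = 2 * N) :
    (laplacian e ^ N) (p * q) = 0 := by
  induction N generalizing k r p q with
  | zero => omega
  | succ N ih =>
    obtain ⟨k, rfl⟩ : ∃ k', k = k' + 1 := ⟨k - 1, by omega⟩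
    -- Every term of Δ(pq) is again a product whose first factor is harmonic and of larger degree: p
    -- with Δq, and ∂_i p with ∂_i q.
    rw [pow_succ, Module.End.mul_apply, laplacian_mul_of_harmonic e hp0, map_add, map_smul,
      map_sum, Finset.sum_eq_zero, smul_zero, zero_add]
    · rcases lt_or_ge r 2 with hr | hr
      · rw [hq.laplacian_eq_zero e hr, mul_zero, map_zero]
      · obtain ⟨r, rfl⟩ := Nat.exists_eq_add_of_le' hr
        exact ih hp hp0 (hq.laplacian e) (by omega) (by omega)
    · intro i _
      rcases r with _ | r
      · rw [hq.partialDeriv_zero, mul_zero, map_zero]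
      · exact ih (hp.partialDeriv _) (by rw [laplacian_partialDeriv, hp0, map_zero])
          (hq.partialDeriv _) (by omega) (by omega)

/-- For `p` harmonic of degree `k` and `q` homogeneous of degree `k + 2d`, the scalar
`Δ^(k+d) (p q)` depends on `q` through `Δ^d q` only. -/
theorem laplacian_pow_mul (N : ℕ) {k d : ℕ} {p q : SymmetricAlgebra ℝ V}
    (hp : IsHomogeneousOfDegree k p) (hp0 : laplacian e p = 0)
    (hq : IsHomogeneousOfDegree (k + 2 * d) q) (hN : k + d = N) :
    (laplacian e ^ N) (p * q) =
      (N.choose k : ℝ) • (laplacian e ^ k) (p * (laplacian e ^ d) q) := by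
  induction N generalizing k d p q with
  | zero =>
    obtain rfl : k = 0 := by omega
    obtain rfl : d = 0 := by omega
    simp
  | succ N ih =>
    rcases k with _ | k
    · obtain ⟨a, rfl⟩ := isHomogeneousOfDegree_zero_iff.1 hp
      obtain rfl : d = N + 1 := by omega
      simp [← Algebra.smul_def]
    rcases d with _ | d
    · obtain rfl : k = N := by omega
      simp
    rw [pow_succ, Module.End.mul_apply, laplacian_mul_of_harmonic e hp0, map_add, map_smul,
      map_sum]
    have h1 : ∀ i, (laplacian e ^ N) (partialDeriv (e.coord i) p * partialDeriv (e.coord i) q) =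
        (N.choose k : ℝ) • (laplacian e ^ k) (partialDeriv (e.coord i) p *
          partialDeriv (e.coord i) ((laplacian e ^ (d + 1)) q)) := fun i => by
      rw [← laplacian_pow_partialDeriv]
      refine ih (hp.partialDeriv _) (by rw [laplacian_partialDeriv, hp0, map_zero]) ?_ (by omega)
      have : k + 1 + 2 * (d + 1) = k + 2 * (d + 1) + 1 := by ring
      rw [this] at hq
      exact hq.partialDeriv _
    have h2 : (laplacian e ^ N) (p * laplacian e q) = (N.choose (k + 1) : ℝ) •
        (laplacian e ^ (k + 1)) (p * (laplacian e ^ (d + 1)) q) := by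
      rw [ih hp hp0 (hq.laplacian e (n := k + 1 + 2 * d)) (by omega), pow_succ (laplacian e) d]
      rfl
    -- The degree of Δ^(d+2) q is smaller than that of p, so only the cross term of Δ(p Δ^(d+1) q)
    -- survives in `h4`.
    have h3 : (laplacian e ^ k) (p * laplacian e ((laplacian e ^ (d + 1)) q)) = 0 := by
      have hr : IsHomogeneousOfDegree (k + 1) ((laplacian e ^ (d + 1)) q) := hq.laplacian_pow e _
      rcases k with _ | k
      · rw [hr.laplacian_eq_zero e (by omega), mul_zero, map_zero]
      · exact laplacian_pow_mul_eq_zero e _ hp hp0 (hr.laplacian e) (by omega) (by omega)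
    have h4 : (laplacian e ^ (k + 1)) (p * (laplacian e ^ (d + 1)) q) =
        (2 : ℝ) • ∑ i, (laplacian e ^ k) (partialDeriv (e.coord i) p *
          partialDeriv (e.coord i) ((laplacian e ^ (d + 1)) q)) := by
      rw [pow_succ (laplacian e) k, Module.End.mul_apply, laplacian_mul_of_harmonic e hp0,
        map_add, h3, add_zero, map_smul, map_sum]
    simp only [h1]
    -- Pascal's rule: `h1` contributes C(N, k) and `h2` contributes C(N, k+1).
    rw [h2, ← Finset.smul_sum, smul_comm, ← h4, ← add_smul, Nat.choose_succ_succ, Nat.cast_add]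

/-- For harmonic p, Δ(p²) = 2 Σ (∂_i p)², and each ∂_i p is harmonic of one degree less, so
induction yields a sum of nonnegative scalars. If the sum vanishes, all ∂_i p vanish, and Euler's
identity gives p = 0. -/
theorem laplacian_pow_sq_aux {k : ℕ} {p : SymmetricAlgebra ℝ V}
    (hp : IsHomogeneousOfDegree k p) (hp0 : laplacian e p = 0) :
    ∃ c : ℝ, 0 ≤ c ∧ (laplacian e ^ k) (p * p) = algebraMap ℝ _ c ∧ (c = 0 → p = 0) := by
  induction k generalizing p with
  | zero =>
    obtain ⟨a, rfl⟩ := isHomogeneousOfDegree_zero_iff.1 hp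
    exact ⟨a * a, mul_self_nonneg a, by simp, by simp⟩
  | succ k ih =>
    have := fun i => ih (hp.partialDeriv (e.coord i))
      (by rw [laplacian_partialDeriv, hp0, map_zero])
    choose c hc h1 h2 using this
    refine ⟨2 * ∑ i, c i, mul_nonneg two_pos.le (Finset.sum_nonneg fun i _ => hc i), ?_, ?_⟩
    · rw [pow_succ, Module.End.mul_apply, laplacian_mul_of_harmonic e hp0, hp0, mul_zero,
        add_zero, map_smul, map_sum]
      simp only [h1]
      rw [← map_sum, Algebra.smul_def, ← map_mul]
    · intro h
      have h3 : ∑ i, c i = 0 := by linarith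
      rw [Finset.sum_eq_zero_iff_of_nonneg fun i _ => hc i] at h3
      have h4 := hp.euler e
      rw [Finset.sum_eq_zero fun i hi => by rw [h2 i (h3 i hi), mul_zero]] at h4
      exact (smul_eq_zero.1 h4.symm).resolve_left (by positivity)

/-- The Fischer norm of a nonzero harmonic polynomial is positive. -/
theorem exists_laplacian_pow_sq {k : ℕ} {p : SymmetricAlgebra ℝ V}
    (hp : IsHomogeneousOfDegree k p) (hp0 : laplacian e p = 0) (hne : p ≠ 0) :
    ∃ c : ℝ, 0 < c ∧ (laplacian e ^ k) (p * p) = algebraMap ℝ _ c := by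
  obtain ⟨c, hc, h1, h2⟩ := laplacian_pow_sq_aux e hp hp0
  exact ⟨c, lt_of_le_of_ne hc fun h => hne (h2 h.symm), h1⟩

end Harmonic

/-! ### Parseval frames -/

section Frame

variable {κ : Type*} {e : Module.Basis κ ℝ V} {B : LinearMap.BilinForm ℝ V}

theorem IsOrthonormalBasis.form_eq_coord (he : IsOrthonormalBasis B e) (i : κ) :
    B (e i) = e.coord i := by
  classical
  refine e.ext fun j => ?_
  rw [Module.Basis.coord_apply, Module.Basis.repr_self, Finsupp.single_apply]
  split_ifs with h
  · rw [h, he.1]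
  · exact he.2 _ _ (Ne.symm h)

theorem IsOrthonormalBasis.sum_form_smul [Fintype κ] (he : IsOrthonormalBasis B e) (v : V) :
    ∑ i, B (e i) v • e i = v := by
  conv_rhs => rw [← e.sum_repr v]
  refine Finset.sum_congr rfl fun i _ => ?_
  rw [he.form_eq_coord]
  rfl

theorem form_eq_sum_of_frame {σ : Type*} [Fintype σ] {w : σ → V}
    (hw : ∀ v, ∑ j, B (w j) v • w j = v) (v : V) : B v = ∑ j, B (w j) v • B (w j) := by
  conv_lhs => rw [← hw v]
  simp

/-- The Laplacian can be computed in any Parseval frame. -/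
theorem IsOrthonormalBasis.laplacian_eq_frame [Fintype κ] (he : IsOrthonormalBasis B e)
    (hB : ∀ x y, B x y = B y x) {σ : Type*} [Fintype σ] {w : σ → V}
    (hw : ∀ v, ∑ j, B (w j) v • w j = v) (p : SymmetricAlgebra ℝ V) :
    laplacian e p = ∑ j, partialDeriv (B (w j)) (partialDeriv (B (w j)) p) := by
  have h1 : ∀ i (q : SymmetricAlgebra ℝ V), partialDeriv (e.coord i) q =
      ∑ j, B (w j) (e i) • partialDeriv (B (w j)) q := fun i q => by
    rw [← he.form_eq_coord, form_eq_sum_of_frame hw (e i), partialDeriv_sum_smul]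
  have h2 : ∀ j (q : SymmetricAlgebra ℝ V), partialDeriv (B (w j)) q =
      ∑ i, B (w j) (e i) • partialDeriv (e.coord i) q := fun j q => by
    conv_lhs => rw [form_eq_sum_of_frame he.sum_form_smul (w j), partialDeriv_sum_smul]
    refine Finset.sum_congr rfl fun i _ => ?_
    rw [hB, he.form_eq_coord]
  calc laplacian e p = ∑ i, ∑ j, B (w j) (e i) •
        partialDeriv (B (w j)) (partialDeriv (e.coord i) p) := by
        rw [laplacian_apply]
        exact Finset.sum_congr rfl fun i _ => h1 i _
    _ = ∑ j, partialDeriv (B (w j)) (partialDeriv (B (w j)) p) := by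
        rw [Finset.sum_comm]
        refine Finset.sum_congr rfl fun j _ => ?_
        conv_rhs => rw [h2 j p, map_sum]
        simp only [Derivation.map_smul]

end Frame

end Calculus

theorem partialDeriv_prod {V κ : Type*} [AddCommGroup V] [Module ℝ V] [DecidableEq κ]
    (ξ : Module.Dual ℝ V) (s : Finset κ) (w : κ → V) :
    partialDeriv ξ (∏ i ∈ s, ι ℝ V (w i)) =
      ∑ i ∈ s, ξ (w i) • ∏ j ∈ s.erase i, ι ℝ V (w j) := by
  induction s using Finset.induction_on with
  | empty => simp
  | insert a s ha ih =>
    rw [Finset.prod_insert ha, Derivation.leibniz, ih, Finset.sum_insert ha,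
      Finset.erase_insert ha, partialDeriv_ι, add_comm, smul_eq_mul, smul_eq_mul, mul_comm _
      (algebraMap _ _ _), ← Algebra.smul_def, Finset.mul_sum]
    congr 1
    refine Finset.sum_congr rfl fun i hi => ?_
    have hai : a ≠ i := fun h => ha (h ▸ hi)
    rw [Finset.erase_insert_of_ne hai, Finset.prod_insert (fun h => ha (Finset.mem_of_mem_erase h)),
      mul_smul_comm]

/-! ### Radial part of the Laplacian on invariants -/

variable {g : Type*} [LieRing g] [LieAlgebra ℝ g]

/-- The derivation of `S(g)` that extends `ad y`. -/
def adDeriv (y : g) : Derivation ℝ (SymmetricAlgebra ℝ g) (SymmetricAlgebra ℝ g) :=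
  extendDerivation (SymmetricAlgebra.ι ℝ g ∘ₗ (LieAlgebra.ad ℝ g y))

@[simp] theorem adDeriv_ι (y w : g) : adDeriv y (ι ℝ g w) = ι ℝ g ⁅y, w⁆ := by
  simp [adDeriv]

namespace InvariantInnerProduct

variable (B : InvariantInnerProduct g)

/-- On a generator w the commutator is -B(v, [y, w]), which is B([y, v], w) by invariance. -/
theorem adDeriv_partialDeriv (y v : g) (p : SymmetricAlgebra ℝ g) :
    adDeriv y (partialDeriv (B.form v) p) =
      partialDeriv (B.form v) (adDeriv y p) + partialDeriv (B.form ⁅y, v⁆) p := by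
  refine lie_derivation_ext (fun w => ?_) p
  simp only [partialDeriv_ι, adDeriv_ι, Derivation.map_algebraMap, zero_sub]
  rw [B.invariant y v w, map_neg]

theorem isInvariant_laplacian {κ : Type*} [Fintype κ] {e : Module.Basis κ ℝ g}
    (he : IsOrthonormalBasis B.form e) {p : SymmetricAlgebra ℝ g} (hp : IsInvariant p) :
    IsInvariant (laplacian e p) := by
  intro y
  have hp' : adDeriv y p = 0 := hp y
  change adDeriv y (laplacian e p) = 0
  have h1 : ∀ i, adDeriv y (partialDeriv (B.form (e i)) (partialDeriv (B.form (e i)) p)) =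
      (2 : ℝ) • partialDeriv (B.form ⁅y, e i⁆) (partialDeriv (B.form (e i)) p) := fun i => by
    rw [B.adDeriv_partialDeriv, B.adDeriv_partialDeriv, hp', map_zero, zero_add,
      partialDeriv_comm (B.form (e i)), two_smul]
  have h2 : ∀ i (q : SymmetricAlgebra ℝ g), partialDeriv (B.form ⁅y, e i⁆) q =
      ∑ j, B.form (e j) ⁅y, e i⁆ • partialDeriv (B.form (e j)) q := fun i q => by
    conv_lhs => rw [form_eq_sum_of_frame he.sum_form_smul ⁅y, e i⁆, partialDeriv_sum_smul]
  -- The coefficients B(e_j, [y, e_i]) are skew in (i, j) while second derivatives are symmetric, so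
  -- the sum equals its own negative.
  have h3 : ∑ i, ∑ j, B.form (e j) ⁅y, e i⁆ •
      partialDeriv (B.form (e j)) (partialDeriv (B.form (e i)) p) = 0 := by
    refine (smul_eq_zero_iff_right (two_ne_zero (α := ℝ))).1 ?_
    rw [two_smul, add_eq_zero_iff_eq_neg]
    conv_lhs => rw [Finset.sum_comm]
    simp only [← Finset.sum_neg_distrib]
    refine Finset.sum_congr rfl fun i _ => Finset.sum_congr rfl fun j _ => ?_
    rw [partialDeriv_comm, ← neg_smul, B.symm (e j), B.invariant, neg_neg]
  rw [laplacian_apply]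
  simp only [← he.form_eq_coord, map_sum, h1, h2]
  rw [← Finset.smul_sum, h3, smul_zero]

variable (h : LieSubalgebra ℝ g) [FiniteDimensional ℝ g]

/-- The orthogonal projection `g → h`. -/
def proj : g →ₗ[ℝ] h :=
  (B.dualVec h).toLinearMap ∘ₗ B.form.compl₂ (h.incl : h →ₗ[ℝ] g)

@[simp] theorem restriction_ι (w : g) :
    B.restriction h (ι ℝ g w) = ι ℝ h (B.proj h w) := by
  rw [restriction, SymmetricAlgebra.lift_ι_apply]
  rfl

theorem form_proj (w : g) (x : h) : B.form (B.proj h w) x = B.form w x :=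
  B.form_dualVec h _ x

variable {h}

theorem eq_dualVec_of_form_eq {α : Module.Dual ℝ h} {y : h}
    (H : ∀ x : h, B.form y x = α x) : y = B.dualVec h α := by
  have h0 : ∀ x : h, B.restrict h (y - B.dualVec h α) x = 0 := fun x => by
    rw [map_sub, LinearMap.sub_apply, restrict_apply, restrict_apply, H, form_dualVec, sub_self]
  exact sub_eq_zero.1 ((B.restrict_nondegenerate h).1 _ h0)

/-- Pairing with x ∈ h: B([u, w], x) = B(w, [x, u]) = α(x) B(v, w). -/
theorem proj_lie {α : Module.Dual ℝ h} {u v : g} (hu : ∀ x : h, ⁅(x : g), u⁆ = α x • v) (w : g) :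
    B.proj h ⁅u, w⁆ = B.form v w • B.dualVec h α := by
  rw [← map_smul]
  refine B.eq_dualVec_of_form_eq fun x => ?_
  rw [form_proj, B.invariant u w x, ← lie_skew, hu, map_neg, neg_neg, map_smul, B.symm w]
  simp [mul_comm]

/-- On h* the vector field of ad u is transverse and equals t_α times the derivative along v. Both
sides obey the Leibniz rule along `restriction`, which reduces the claim to `proj_lie`. -/
theorem restriction_adDeriv {α : Module.Dual ℝ h} {u v : g}
    (hu : ∀ x : h, ⁅(x : g), u⁆ = α x • v) (q : SymmetricAlgebra ℝ g) :
    B.restriction h (adDeriv u q) =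
      ι ℝ h (B.dualVec h α) * B.restriction h (partialDeriv (B.form v) q) := by
  let F : SymmetricAlgebra ℝ g →ₗ[ℝ] SymmetricAlgebra ℝ h :=
    (B.restriction h).toLinearMap ∘ₗ (adDeriv u).toLinearMap
  let G : SymmetricAlgebra ℝ g →ₗ[ℝ] SymmetricAlgebra ℝ h :=
    LinearMap.mulLeft ℝ (ι ℝ h (B.dualVec h α)) ∘ₗ (B.restriction h).toLinearMap ∘ₗ
      (partialDeriv (B.form v)).toLinearMap
  have : F = G := by
    refine leibniz_ext (B.restriction h) (fun a b => ?_) (fun a b => ?_) fun w => ?_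
    · simp [F]
    · simp [G]
      ring
    · simp [F, G, B.proj_lie hu, Algebra.smul_def, mul_comm]
  exact LinearMap.congr_fun this q

theorem restriction_partialDeriv (t : h) (p : SymmetricAlgebra ℝ g) :
    B.restriction h (partialDeriv (B.form t) p) =
      partialDeriv (B.restrict h t) (B.restriction h p) := by
  let F : SymmetricAlgebra ℝ g →ₗ[ℝ] SymmetricAlgebra ℝ h :=
    (B.restriction h).toLinearMap ∘ₗ (partialDeriv (B.form t)).toLinearMap
  let G : SymmetricAlgebra ℝ g →ₗ[ℝ] SymmetricAlgebra ℝ h :=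
    (partialDeriv (B.restrict h t)).toLinearMap ∘ₗ (B.restriction h).toLinearMap
  have : F = G := by
    refine leibniz_ext (B.restriction h) (fun a b => ?_) (fun a b => ?_) fun w => ?_
    · simp [F]
    · simp [G]
    · simp [F, G, B.symm t, B.form_proj]
  exact LinearMap.congr_fun this p

/-- Apply `restriction_adDeriv` to ∂_v p. Since ad u kills p, moving it past ∂_v leaves only the
derivative along [u, v] = t_α, which is tangent to h*. -/
theorem radial_part_root {α : Module.Dual ℝ h} {u v : g}
    (hu : ∀ x : h, ⁅(x : g), u⁆ = α x • v) (huv : ⁅u, v⁆ = B.dualVec h α)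
    {p : SymmetricAlgebra ℝ g} (hp : IsInvariant p) :
    ι ℝ h (B.dualVec h α) *
        B.restriction h (partialDeriv (B.form v) (partialDeriv (B.form v) p)) =
      partialDeriv (B.restrict h (B.dualVec h α)) (B.restriction h p) := by
  have hp' : adDeriv u p = 0 := hp u
  rw [← B.restriction_adDeriv hu, B.adDeriv_partialDeriv, hp', map_zero, zero_add, huv,
    restriction_partialDeriv]

/-- Vectors `u α`, `v α` for `α ∈ P` that span the real root planes of `g`. -/
structure IsRootFrame (P : Finset (Module.Dual ℝ h)) (u v : Module.Dual ℝ h → g) : Prop where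
  lie_u : ∀ α ∈ P, ∀ x : h, ⁅(x : g), u α⁆ = α x • v α
  lie_v : ∀ α ∈ P, ∀ x : h, ⁅(x : g), v α⁆ = -(α x • u α)
  lie_u_v : ∀ α ∈ P, ⁅u α, v α⁆ = B.dualVec h α
  parseval : ∀ w : g, (B.proj h w : g) +
    ∑ α ∈ P, (B.form (u α) w • u α + B.form (v α) w • v α) = w

/-- The product of the positive roots, as an element of `S(h)`. -/
def rootProd (B : InvariantInnerProduct g) (P : Finset (Module.Dual ℝ h)) :
    SymmetricAlgebra ℝ h :=
  ∏ α ∈ P, ι ℝ h (B.dualVec h α)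

variable {P : Finset (Module.Dual ℝ h)} {u v : Module.Dual ℝ h → g}

theorem sum_form_smul_eq_proj {n : Type*} [Fintype n] {f : Module.Basis n ℝ h}
    (hf : IsOrthonormalBasis (B.restrict h) f) (w : g) :
    ∑ i, B.form (f i) w • f i = B.proj h w := by
  conv_rhs => rw [← hf.sum_form_smul (B.proj h w)]
  refine Finset.sum_congr rfl fun i _ => ?_
  rw [restrict_apply, B.symm (f i) (B.proj h w), form_proj, B.symm]

/-- An orthonormal basis of h together with the root vectors is a Parseval frame of g. -/
theorem IsRootFrame.laplacian_eq (hF : B.IsRootFrame P u v) {m n : Type*} [Fintype m] [Fintype n]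
    {e : Module.Basis m ℝ g} {f : Module.Basis n ℝ h} (he : IsOrthonormalBasis B.form e)
    (hf : IsOrthonormalBasis (B.restrict h) f) (p : SymmetricAlgebra ℝ g) :
    laplacian e p = ∑ i, partialDeriv (B.form (f i)) (partialDeriv (B.form (f i)) p) +
      ∑ α ∈ P, (partialDeriv (B.form (u α)) (partialDeriv (B.form (u α)) p) +
        partialDeriv (B.form (v α)) (partialDeriv (B.form (v α)) p)) := by
  have hw : ∀ x, ∑ j : n ⊕ P ⊕ P,
      B.form (Sum.elim (fun i => (f i : g)) (Sum.elim (fun α : P => u α) (fun α : P => v α)) j) x •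
        (Sum.elim (fun i => (f i : g)) (Sum.elim (fun α : P => u α) (fun α : P => v α)) j) = x := by
    intro x
    conv_rhs => rw [← hF.parseval x, ← B.sum_form_smul_eq_proj hf]
    simp only [Fintype.sum_sum_type, Sum.elim_inl, Sum.elim_inr]
    rw [Finset.sum_coe_sort P (fun α => B.form (u α) x • u α),
      Finset.sum_coe_sort P (fun α => B.form (v α) x • v α), ← Finset.sum_add_distrib]
    simp
  rw [he.laplacian_eq_frame B.symm hw]
  simp only [Fintype.sum_sum_type, Sum.elim_inl, Sum.elim_inr]
  rw [Finset.sum_coe_sort P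
      (fun α => partialDeriv (B.form (u α)) (partialDeriv (B.form (u α)) p)),
    Finset.sum_coe_sort P (fun α => partialDeriv (B.form (v α)) (partialDeriv (B.form (v α)) p)),
    ← Finset.sum_add_distrib]

/-- The radial part of the Laplacian on invariant polynomials. -/
theorem IsRootFrame.rootProd_mul_restriction_laplacian (hF : B.IsRootFrame P u v)
    {m n : Type*} [Fintype m] [Fintype n]
    {e : Module.Basis m ℝ g} {f : Module.Basis n ℝ h} (he : IsOrthonormalBasis B.form e)
    (hf : IsOrthonormalBasis (B.restrict h) f) (h0 : laplacian f (B.rootProd P) = 0)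
    {p : SymmetricAlgebra ℝ g} (hp : IsInvariant p) :
    B.rootProd P * B.restriction h (laplacian e p) =
      laplacian f (B.rootProd P * B.restriction h p) := by
  classical
  have hv : ∀ α ∈ P, ι ℝ h (B.dualVec h α) *
        B.restriction h (partialDeriv (B.form (v α)) (partialDeriv (B.form (v α)) p)) =
      partialDeriv (B.restrict h (B.dualVec h α)) (B.restriction h p) := fun α hα =>
    B.radial_part_root (hF.lie_u α hα) (hF.lie_u_v α hα) hp
  have hu : ∀ α ∈ P, ι ℝ h (B.dualVec h α) *
        B.restriction h (partialDeriv (B.form (u α)) (partialDeriv (B.form (u α)) p)) =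
      partialDeriv (B.restrict h (B.dualVec h α)) (B.restriction h p) := fun α hα => by
    -- The pair (v, -u) satisfies the same relations as (u, v), and the sign disappears in the
    -- second derivative.
    have := B.radial_part_root (α := α) (u := v α) (v := (-1 : ℝ) • u α)
      (fun x => by rw [hF.lie_v α hα]; simp)
      (by rw [neg_one_smul, lie_neg, lie_skew, hF.lie_u_v α hα]) hp
    rw [← this]
    simp only [map_smul, partialDeriv_smul, Derivation.smul_apply, Derivation.map_smul, smul_smul]
    norm_num
  have h1 : ∀ α ∈ P, B.rootProd P * B.restriction h
        (partialDeriv (B.form (u α)) (partialDeriv (B.form (u α)) p) +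
          partialDeriv (B.form (v α)) (partialDeriv (B.form (v α)) p)) =
      (2 : ℝ) • ((∏ β ∈ P.erase α, ι ℝ h (B.dualVec h β)) *
        partialDeriv (B.restrict h (B.dualVec h α)) (B.restriction h p)) := fun α hα => by
    rw [rootProd, ← Finset.prod_erase_mul _ _ hα, map_add, mul_add, mul_assoc, mul_assoc,
      hu α hα, hv α hα, two_smul]
  have h2 : B.restriction h (∑ i, partialDeriv (B.form (f i)) (partialDeriv (B.form (f i)) p)) =
      laplacian f (B.restriction h p) := by
    rw [laplacian_apply, map_sum]
    refine Finset.sum_congr rfl fun i _ => ?_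
    rw [restriction_partialDeriv, restriction_partialDeriv, hf.form_eq_coord]
  -- The gradient of π is Σ (π/α) t_α, so the cross term of Δ(π P(p)) reproduces the contribution of
  -- the root planes.
  have h3 : ∑ i, partialDeriv (f.coord i) (B.rootProd P) *
        partialDeriv (f.coord i) (B.restriction h p) =
      ∑ α ∈ P, (∏ β ∈ P.erase α, ι ℝ h (B.dualVec h β)) *
        partialDeriv (B.restrict h (B.dualVec h α)) (B.restriction h p) := by
    simp only [rootProd, partialDeriv_prod, Finset.sum_mul]
    rw [Finset.sum_comm]
    refine Finset.sum_congr rfl fun α _ => ?_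
    rw [form_eq_sum_of_frame hf.sum_form_smul (B.dualVec h α), partialDeriv_sum_smul,
      Finset.mul_sum]
    refine Finset.sum_congr rfl fun i _ => ?_
    rw [hf.form_eq_coord, smul_mul_assoc, mul_smul_comm]
  rw [hF.laplacian_eq B he hf, map_add, mul_add, h2, map_sum, Finset.mul_sum,
    Finset.sum_congr rfl h1, ← Finset.smul_sum, ← h3, laplacian_mul_of_harmonic f h0, add_comm]

theorem IsRootFrame.rootProd_mul_restriction_laplacian_pow (hF : B.IsRootFrame P u v)
    {m n : Type*} [Fintype m] [Fintype n]
    {e : Module.Basis m ℝ g} {f : Module.Basis n ℝ h} (he : IsOrthonormalBasis B.form e)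
    (hf : IsOrthonormalBasis (B.restrict h) f) (h0 : laplacian f (B.rootProd P) = 0) (d : ℕ)
    {p : SymmetricAlgebra ℝ g} (hp : IsInvariant p) :
    B.rootProd P * B.restriction h ((laplacian e ^ d) p) =
      (laplacian f ^ d) (B.rootProd P * B.restriction h p) := by
  induction d generalizing p with
  | zero => rfl
  | succ d ih =>
    rw [pow_succ, Module.End.mul_apply, ih (B.isInvariant_laplacian he hp),
      hF.rootProd_mul_restriction_laplacian B he hf h0 hp, pow_succ, Module.End.mul_apply]

theorem isHomogeneousOfDegree_restriction {n : ℕ} {p : SymmetricAlgebra ℝ g}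
    (hp : IsHomogeneousOfDegree n p) : IsHomogeneousOfDegree n (B.restriction h p) := by
  induction n generalizing p with
  | zero =>
    obtain ⟨a, rfl⟩ := isHomogeneousOfDegree_zero_iff.1 hp
    exact isHomogeneousOfDegree_zero_iff.2 ⟨a, by simp⟩
  | succ n ih =>
    refine hp.induction (C := fun p => IsHomogeneousOfDegree _ (B.restriction h p))
      (fun a v ha => ?_) fun a b ha hb => ?_
    · rw [map_mul, restriction_ι]
      exact (ih ha).mul (isHomogeneousOfDegree_ι _)
    · rw [map_add]; exact ha.add hb

end InvariantInnerProduct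

/-! ### Divisibility by linear forms, grading, and orthogonal substitutions -/

section SymMap

variable {V : Type*} [AddCommGroup V] [Module ℝ V]

/-- The algebra endomorphism of `S(V)` induced by a linear endomorphism of `V`. -/
def symMap (T : V →ₗ[ℝ] V) : SymmetricAlgebra ℝ V →ₐ[ℝ] SymmetricAlgebra ℝ V :=
  SymmetricAlgebra.lift (ι ℝ V ∘ₗ T)

@[simp] theorem symMap_ι (T : V →ₗ[ℝ] V) (v : V) : symMap T (ι ℝ V v) = ι ℝ V (T v) := by
  simp [symMap]

theorem ι_eq_zero_iff {v : V} : ι ℝ V v = 0 ↔ v = 0 := by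
  refine ⟨fun hv => ?_, fun hv => by rw [hv, map_zero]⟩
  rw [← Module.forall_dual_apply_eq_zero_iff ℝ]
  intro ξ
  have := congrArg (evalAt ξ) hv
  rwa [evalAt, SymmetricAlgebra.lift_ι_apply, map_zero] at this

/-- T is the identity modulo a on V, hence so is the induced algebra map modulo the ideal (a). This
is used both for projections along a and for reflections. -/
theorem ι_dvd_symMap_sub {T : V →ₗ[ℝ] V} {a : V} (hT : ∀ v, ∃ c : ℝ, T v - v = c • a)
    (p : SymmetricAlgebra ℝ V) : ι ℝ V a ∣ symMap T p - p := by
  induction p using SymmetricAlgebra.induction with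
  | algebraMap r => simp
  | ι x =>
    obtain ⟨c, hc⟩ := hT x
    rw [symMap_ι, ← map_sub, hc, map_smul]
    exact dvd_smul_of_dvd c (dvd_refl _)
  | mul p q hp hq =>
    have : symMap T (p * q) - p * q =
        symMap T p * (symMap T q - q) + (symMap T p - p) * q := by rw [map_mul]; ring
    rw [this]
    exact (hq.mul_left _).add (hp.mul_right _)
  | add p q hp hq =>
    have : symMap T (p + q) - (p + q) = (symMap T p - p) + (symMap T q - q) := by
      rw [map_add]; ring
    rw [this]
    exact hp.add hq

theorem ι_dvd_iff_symMap_eq_zero {T : V →ₗ[ℝ] V} {a : V} (hT : ∀ v, ∃ c : ℝ, T v - v = c • a)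
    (ha : T a = 0) (p : SymmetricAlgebra ℝ V) : ι ℝ V a ∣ p ↔ symMap T p = 0 := by
  constructor
  · rintro ⟨q, rfl⟩
    rw [map_mul, symMap_ι, ha, map_zero, zero_mul]
  · intro hp
    have := ι_dvd_symMap_sub hT p
    rwa [hp, zero_sub, dvd_neg] at this

theorem exists_projection_along {a : V} (ha : a ≠ 0) :
    ∃ T : V →ₗ[ℝ] V, (∀ v, ∃ c : ℝ, T v - v = c • a) ∧ T a = 0 := by
  obtain ⟨f, hf⟩ := Module.Projective.exists_dual_eq_one ℝ ha
  exact ⟨LinearMap.id - f.smulRight a, fun v => ⟨-f v, by simp⟩, by simp [hf]⟩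

theorem ι_dvd_ι_iff {a b : V} (ha : a ≠ 0) : ι ℝ V a ∣ ι ℝ V b ↔ ∃ c : ℝ, b = c • a := by
  obtain ⟨T, hT, hTa⟩ := exists_projection_along ha
  rw [ι_dvd_iff_symMap_eq_zero hT hTa, symMap_ι, ι_eq_zero_iff]
  constructor
  · intro hb
    obtain ⟨c, hc⟩ := hT b
    exact ⟨-c, by rw [neg_smul, ← hc, hb, zero_sub, neg_neg]⟩
  · rintro ⟨c, rfl⟩
    rw [map_smul, hTa, smul_zero]

/-- The ideal (a) is the kernel of the algebra map induced by a projection along a, and S(V) is a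
domain. -/
theorem prime_ι {a : V} (ha : a ≠ 0) : Prime (ι ℝ V a) := by
  obtain ⟨T, hT, hTa⟩ := exists_projection_along ha
  have hdvd := ι_dvd_iff_symMap_eq_zero hT hTa
  refine ⟨fun h => ha (ι_eq_zero_iff.1 h), fun h => ?_, fun p q hpq => ?_⟩
  · have := h.map (symMap T)
    rw [symMap_ι, hTa, map_zero] at this
    exact not_isUnit_zero this
  · rw [hdvd, map_mul, mul_eq_zero] at hpq
    rwa [hdvd, hdvd]

/-- Non-proportional linear forms are primes that do not divide one another, so they can be split
off one at a time. -/
theorem prod_ι_dvd {κ : Type*} {s : Finset κ} {t : κ → V} (h0 : ∀ i ∈ s, t i ≠ 0)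
    (h1 : ∀ i ∈ s, ∀ j ∈ s, ∀ c : ℝ, t j = c • t i → j = i) {p : SymmetricAlgebra ℝ V}
    (hp : ∀ i ∈ s, ι ℝ V (t i) ∣ p) : ∏ i ∈ s, ι ℝ V (t i) ∣ p := by
  classical
  induction s using Finset.induction_on generalizing p with
  | empty => simp
  | insert a s has ih =>
    simp only [Finset.mem_insert, forall_eq_or_imp] at h0 hp
    obtain ⟨q, rfl⟩ := hp.1
    rw [Finset.prod_insert has]
    refine mul_dvd_mul_left _ (ih h0.2 (fun i hi j hj => h1 i (Finset.mem_insert_of_mem hi) j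
      (Finset.mem_insert_of_mem hj)) fun i hi => ?_)
    refine ((prime_ι (h0.2 i hi)).dvd_or_dvd (hp.2 i hi)).resolve_left fun hd => ?_
    obtain ⟨c, hc⟩ := (ι_dvd_ι_iff (h0.2 i hi)).1 hd
    refine has ?_
    rwa [h1 i (Finset.mem_insert_of_mem hi) a (Finset.mem_insert_self _ _) c hc]

/-- The grading of `S(V)`, as an algebra homomorphism to `S(V)[X]`. -/
def gradingHom : SymmetricAlgebra ℝ V →ₐ[ℝ] Polynomial (SymmetricAlgebra ℝ V) :=
  SymmetricAlgebra.lift (LinearMap.mulLeft ℝ Polynomial.X ∘ₗ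
    (Polynomial.CAlgHom (R := ℝ) (A := SymmetricAlgebra ℝ V)).toLinearMap ∘ₗ ι ℝ V)

theorem gradingHom_ι (v : V) :
    gradingHom (ι ℝ V v) = Polynomial.X * Polynomial.C (ι ℝ V v) := by
  simp [gradingHom]

theorem IsHomogeneousOfDegree.gradingHom_eq {n : ℕ} {p : SymmetricAlgebra ℝ V}
    (hp : IsHomogeneousOfDegree n p) : gradingHom p = Polynomial.X ^ n * Polynomial.C p := by
  induction n generalizing p with
  | zero =>
    obtain ⟨a, rfl⟩ := isHomogeneousOfDegree_zero_iff.1 hp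
    rw [AlgHom.commutes, pow_zero, one_mul]
    rfl
  | succ n ih =>
    refine hp.induction (C := fun p => gradingHom p = Polynomial.X ^ (n + 1) * Polynomial.C p)
      (fun a v ha => ?_) fun a b ha hb => ?_
    · rw [map_mul, ih ha, gradingHom_ι, map_mul]
      ring
    · rw [map_add, ha, hb, map_add, mul_add]

/-- Under `gradingHom` the divisibility makes X^m divide X^n q; the coefficient of X^n, which is q,
then vanishes. -/
theorem IsHomogeneousOfDegree.eq_zero_of_dvd {m n : ℕ} {p q : SymmetricAlgebra ℝ V}
    (hp : IsHomogeneousOfDegree m p) (hq : IsHomogeneousOfDegree n q) (hnm : n < m)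
    (hd : p ∣ q) : q = 0 := by
  have h1 : (Polynomial.X : Polynomial (SymmetricAlgebra ℝ V)) ^ m ∣
      Polynomial.X ^ n * Polynomial.C q := by
    rw [← hq.gradingHom_eq]
    refine dvd_trans ?_ (map_dvd gradingHom hd)
    rw [hp.gradingHom_eq]
    exact dvd_mul_right _ _
  have := Polynomial.X_pow_dvd_iff.1 h1 n hnm
  simpa [Polynomial.coeff_X_pow_mul'] using this

/-- A self-adjoint involution is orthogonal, so it carries e to another Parseval frame. -/
theorem laplacian_symMap {κ : Type*} [Fintype κ] {e : Module.Basis κ ℝ V}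
    {B : LinearMap.BilinForm ℝ V} (he : IsOrthonormalBasis B e) (hB : ∀ x y, B x y = B y x)
    {T : V →ₗ[ℝ] V} (hT : ∀ x y, B (T x) y = B x (T y)) (hTT : ∀ x, T (T x) = x)
    (p : SymmetricAlgebra ℝ V) : laplacian e (symMap T p) = symMap T (laplacian e p) := by
  have hd : ∀ v p, partialDeriv (B (T v)) (symMap T p) = symMap T (partialDeriv (B v) p) := by
    intro v
    let F : SymmetricAlgebra ℝ V →ₗ[ℝ] SymmetricAlgebra ℝ V :=
      (partialDeriv (B (T v))).toLinearMap ∘ₗ (symMap T).toLinearMap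
    let G : SymmetricAlgebra ℝ V →ₗ[ℝ] SymmetricAlgebra ℝ V :=
      (symMap T).toLinearMap ∘ₗ (partialDeriv (B v)).toLinearMap
    have : F = G := by
      refine leibniz_ext (symMap T) (fun a b => ?_) (fun a b => ?_) fun w => ?_
      · simp [F]
      · simp [G]
      · simp [F, G, hT, hTT]
    exact fun p => LinearMap.congr_fun this p
  have hw : ∀ v, ∑ j, B (T (e j)) v • T (e j) = v := fun v => by
    conv_rhs => rw [← hTT v, ← he.sum_form_smul (T v), map_sum]
    simp [hT]
  rw [he.laplacian_eq_frame hB hw, laplacian_apply, map_sum]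
  refine Finset.sum_congr rfl fun i _ => ?_
  rw [hd, hd, he.form_eq_coord]

end SymMap

/-! ### Reflections and the product of the positive roots -/

namespace InvariantInnerProduct

variable {g : Type*} [LieRing g] [LieAlgebra ℝ g] [FiniteDimensional ℝ g]
  (B : InvariantInnerProduct g) {h : LieSubalgebra ℝ g}

theorem apply_dualVec_comm (α β : Module.Dual ℝ h) :
    α (B.dualVec h β) = β (B.dualVec h α) := by
  rw [← B.form_dualVec, ← B.form_dualVec h β, B.symm]

theorem apply_dualVec_pos {α : Module.Dual ℝ h} (hα : α ≠ 0) : 0 < α (B.dualVec h α) := by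
  rw [← B.form_dualVec]
  refine B.pos _ fun h0 => hα ?_
  rw [← (B.dualVec h).map_eq_zero_iff]
  exact Subtype.ext h0

/-- The reflection of `h*` in the hyperplane orthogonal to `α`. -/
def reflect (α : Module.Dual ℝ h) : Module.End ℝ (Module.Dual ℝ h) :=
  Module.preReflection α ((2 / α (B.dualVec h α)) • Module.Dual.eval ℝ h (B.dualVec h α))

/-- The reflection of `h` in the kernel of `α`. -/
def reflectVec (α : Module.Dual ℝ h) : Module.End ℝ h :=
  Module.preReflection (B.dualVec h α) ((2 / α (B.dualVec h α)) • α)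

theorem reflect_apply (α β : Module.Dual ℝ h) : B.reflect α β =
    β - (2 * β (B.dualVec h α) / α (B.dualVec h α)) • α := by
  simp [reflect, Module.preReflection_apply, div_mul_eq_mul_div]

theorem reflectVec_apply (α : Module.Dual ℝ h) (x : h) : B.reflectVec α x =
    x - (2 * α x / α (B.dualVec h α)) • B.dualVec h α := by
  simp [reflectVec, Module.preReflection_apply, div_mul_eq_mul_div]

theorem reflect_reflect {α : Module.Dual ℝ h} (hα : α ≠ 0) (β : Module.Dual ℝ h) :
    B.reflect α (B.reflect α β) = β :=
  Module.involutive_preReflection (by simp [(B.apply_dualVec_pos hα).ne']) β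

theorem reflectVec_reflectVec {α : Module.Dual ℝ h} (hα : α ≠ 0) (x : h) :
    B.reflectVec α (B.reflectVec α x) = x :=
  Module.involutive_preReflection (by simp [(B.apply_dualVec_pos hα).ne']) x

theorem reflect_self {α : Module.Dual ℝ h} (hα : α ≠ 0) : B.reflect α α = -α := by
  rw [reflect_apply, mul_div_assoc, div_self (B.apply_dualVec_pos hα).ne', mul_one, two_smul]
  abel

theorem reflectVec_dualVec (α β : Module.Dual ℝ h) :
    B.reflectVec α (B.dualVec h β) = B.dualVec h (B.reflect α β) := by
  rw [reflect_apply, reflectVec_apply, map_sub, map_smul, B.apply_dualVec_comm α β]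

theorem restrict_reflectVec (α : Module.Dual ℝ h) (x y : h) :
    B.restrict h (B.reflectVec α x) y = B.restrict h x (B.reflectVec α y) := by
  have h1 : ∀ x : h, B.restrict h (B.dualVec h α) x = α x := B.form_dualVec h α
  have h2 : ∀ x : h, B.restrict h x (B.dualVec h α) = α x := fun x => by
    rw [← h1 x, restrict_apply, restrict_apply, B.symm]
  simp only [reflectVec_apply, map_sub, map_smul, LinearMap.sub_apply, LinearMap.smul_apply, h1,
    h2, smul_eq_mul]
  ring

/-- The properties of a positive system of a reduced root system that are used below. -/
structure IsReducedPositiveSystem (P : Finset (Module.Dual ℝ h)) : Prop where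
  exists_pos : ∃ x : h, ∀ β ∈ P, 0 < β x
  reflect_mem : ∀ α ∈ P, ∀ β ∈ P, B.reflect α β ∈ P ∨ -B.reflect α β ∈ P
  eq_of_smul : ∀ α ∈ P, ∀ β ∈ P, ∀ c : ℝ, β = c • α → β = α

namespace IsReducedPositiveSystem

variable {B} {P : Finset (Module.Dual ℝ h)} (hP : B.IsReducedPositiveSystem P)
include hP

theorem neg_notMem {α : Module.Dual ℝ h} (hα : α ∈ P) : -α ∉ P := by
  obtain ⟨x, hx⟩ := hP.exists_pos
  intro h
  have h1 := hx _ hα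
  have h2 := hx _ h
  rw [LinearMap.neg_apply] at h2
  linarith

theorem ne_zero {α : Module.Dual ℝ h} (hα : α ∈ P) : α ≠ 0 := by
  rintro rfl
  exact hP.neg_notMem hα (by rwa [neg_zero])

/-- A reflection permutes the positive roots up to signs, and an odd number of the signs is
negative. -/
theorem exists_signed_perm {α : Module.Dual ℝ h} (hα : α ∈ P) :
    ∃ (σ : Module.Dual ℝ h → Module.Dual ℝ h) (ε : Module.Dual ℝ h → ℝ),
      (∀ β ∈ P, σ β ∈ P) ∧ (∀ β ∈ P, σ (σ β) = β) ∧ (∀ β ∈ P, ε (σ β) = ε β) ∧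
      (∀ β ∈ P, B.reflect α β = ε β • σ β) ∧ (∀ β ∈ P, ε β ≤ 1) ∧ ε α = -1 ∧
      ∏ β ∈ P, ε β = -1 := by
  classical
  have hα0 := hP.ne_zero hα
  have hrr := B.reflect_reflect hα0
  set r := B.reflect α with hr
  let σ : Module.Dual ℝ h → Module.Dual ℝ h := fun β => if r β ∈ P then r β else -r β
  let ε : Module.Dual ℝ h → ℝ := fun β => if r β ∈ P then 1 else -1
  have hσ1 : ∀ β, r β ∈ P → σ β = r β := fun β hβ => if_pos hβ
  have hσ2 : ∀ β, r β ∉ P → σ β = -r β := fun β hβ => if_neg hβ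
  have hε1 : ∀ β, r β ∈ P → ε β = 1 := fun β hβ => if_pos hβ
  have hε2 : ∀ β, r β ∉ P → ε β = -1 := fun β hβ => if_neg hβ
  have hσP : ∀ β ∈ P, σ β ∈ P := fun β hβ => by
    by_cases h1 : r β ∈ P
    · rwa [hσ1 β h1]
    · rw [hσ2 β h1]
      exact (hP.reflect_mem α hα β hβ).resolve_left h1
  have hσr : ∀ β, r β ∉ P → r (σ β) = -β := fun β h1 => by
    rw [hσ2 β h1, map_neg, hrr]
  have hσσ : ∀ β ∈ P, σ (σ β) = β := fun β hβ => by
    by_cases h1 : r β ∈ P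
    · rw [hσ1 β h1, hσ1, hrr]
      rwa [hrr]
    · rw [hσ2 (σ β), hσr β h1, neg_neg]
      rw [hσr β h1]
      exact hP.neg_notMem hβ
  have hεσ : ∀ β ∈ P, ε (σ β) = ε β := fun β hβ => by
    by_cases h1 : r β ∈ P
    · rw [hσ1 β h1, hε1 β h1, hε1]
      rwa [hrr]
    · rw [hε2 β h1, hε2]
      rw [hσr β h1]
      exact hP.neg_notMem hβ
  have hεα : ε α = -1 := hε2 _ (by rw [hr, B.reflect_self hα0]; exact hP.neg_notMem hα)
  have hσα : σ α = α := by
    rw [hσ2, hr, B.reflect_self hα0, neg_neg]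
    rw [hr, B.reflect_self hα0]
    exact hP.neg_notMem hα
  have hεsq : ∀ β, ε β * ε β = 1 := fun β => by
    by_cases h1 : r β ∈ P
    · rw [hε1 β h1, one_mul]
    · rw [hε2 β h1]; norm_num
  refine ⟨σ, ε, hσP, hσσ, hεσ, fun β _ => ?_, fun β _ => ?_, hεα, ?_⟩
  · by_cases h1 : r β ∈ P
    · rw [hε1 β h1, hσ1 β h1, one_smul]
    · rw [hε2 β h1, hσ2 β h1]
      exact (by simp : r β = (-1 : ℝ) • -r β)
  · by_cases h1 : r β ∈ P
    · rw [hε1 β h1]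
    · rw [hε2 β h1]; norm_num
  -- The factor ε α is the odd sign. The other factors cancel in pairs β, σ β, because ε takes equal
  -- values of square 1 on them.
  · rw [← Finset.mul_prod_erase P ε hα, hεα,
      Finset.prod_involution (fun β _ => σ β) (fun β hβ => ?_) (fun β hβ h1 => ?_)
        (fun β hβ => ?_) (fun β hβ => ?_), mul_one]
    · rw [hεσ β (Finset.mem_of_mem_erase hβ), hεsq]
    -- A fixed point of σ with sign -1 satisfies r β = -β, so it is a multiple of α; reducedness
    -- gives β = α, which has been removed.
    · intro h2
      have hβP := Finset.mem_of_mem_erase hβ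
      have h3 : r β ∉ P := fun h3 => h1 (hε1 β h3)
      rw [hσ2 β h3, hr, reflect_apply] at h2
      refine Finset.ne_of_mem_erase hβ
        (hP.eq_of_smul α hα β hβP (β (B.dualVec h α) / α (B.dualVec h α)) ?_)
      have h4 : (2 : ℝ) • β = (2 : ℝ) • (β (B.dualVec h α) / α (B.dualVec h α)) • α := by
        rw [smul_smul, ← mul_div_assoc, two_smul]
        nth_rewrite 1 [← h2]
        abel
      exact smul_right_injective _ two_ne_zero h4
    · refine Finset.mem_erase.2 ⟨fun h1 => ?_, hσP β (Finset.mem_of_mem_erase hβ)⟩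
      refine Finset.ne_of_mem_erase hβ ?_
      rw [← hσσ β (Finset.mem_of_mem_erase hβ), h1, hσα]
    · exact hσσ β (Finset.mem_of_mem_erase hβ)

theorem symMap_rootProd {α : Module.Dual ℝ h} (hα : α ∈ P) :
    symMap (B.reflectVec α) (B.rootProd P) = -B.rootProd P := by
  obtain ⟨σ, ε, hσP, hσσ, -, hr, -, -, hε⟩ := hP.exists_signed_perm hα
  rw [rootProd, map_prod]
  calc ∏ β ∈ P, symMap (B.reflectVec α) (ι ℝ h (B.dualVec h β))
      = ∏ β ∈ P, (algebraMap ℝ (SymmetricAlgebra ℝ h) (ε β) * ι ℝ h (B.dualVec h (σ β))) := by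
        refine Finset.prod_congr rfl fun β hβ => ?_
        rw [symMap_ι, reflectVec_dualVec, hr β hβ, map_smul, map_smul, Algebra.smul_def]
    _ = algebraMap ℝ (SymmetricAlgebra ℝ h) (-1) * ∏ β ∈ P, ι ℝ h (B.dualVec h (σ β)) := by
        rw [Finset.prod_mul_distrib, ← map_prod, hε]
    _ = -∏ β ∈ P, ι ℝ h (B.dualVec h β) := by
        rw [map_neg, map_one, neg_one_mul]
        congr 1
        exact Finset.prod_nbij' σ σ hσP hσP hσσ hσσ fun β _ => rfl

/-- The product of the positive roots is harmonic. -/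
theorem laplacian_rootProd {n : Type*} [Fintype n] {f : Module.Basis n ℝ h}
    (hf : IsOrthonormalBasis (B.restrict h) f) : laplacian f (B.rootProd P) = 0 := by
  have hhom : IsHomogeneousOfDegree P.card (B.rootProd P) := isHomogeneousOfDegree_prod _ _
  rcases lt_or_ge P.card 2 with h2 | h2
  · exact hhom.laplacian_eq_zero f h2
  obtain ⟨k, hk⟩ := Nat.exists_eq_add_of_le' h2
  -- It suffices that π divides Δπ, which has smaller degree; divisibility is tested root by root.
  refine IsHomogeneousOfDegree.eq_zero_of_dvd hhom ((hk ▸ hhom).laplacian f) (by omega) ?_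
  refine prod_ι_dvd (fun α hα => ?_) (fun α hα β hβ c hc => ?_) fun α hα => ?_
  · rw [Ne, LinearEquiv.map_eq_zero_iff]
    exact hP.ne_zero hα
  · refine hP.eq_of_smul α hα β hβ c ?_
    rw [← map_smul] at hc
    exact (B.dualVec h).injective hc
  · have h1 : symMap (B.reflectVec α) (laplacian f (B.rootProd P)) =
        -laplacian f (B.rootProd P) := by
      rw [← laplacian_symMap hf (fun x y => B.symm x y) (B.restrict_reflectVec α)
        (B.reflectVec_reflectVec (hP.ne_zero hα)), hP.symMap_rootProd hα, map_neg]
    have h3 := ι_dvd_symMap_sub (T := B.reflectVec α) (a := B.dualVec h α)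
      (fun x => ⟨-(2 * α x / α (B.dualVec h α)), by rw [reflectVec_apply, neg_smul]; abel⟩)
      (laplacian f (B.rootProd P))
    rw [h1] at h3
    -- By anti-invariance `h3` says that t_α divides -2Δπ; the scalar -1/2 undoes this factor.
    have h4 := dvd_smul_of_dvd (-(1 / 2) : ℝ) h3
    convert h4 using 1
    rw [sub_eq_add_neg, ← two_smul ℝ (-laplacian f (B.rootProd P)), smul_smul, smul_neg,
      ← neg_smul]
    norm_num

/-- If (ρ, α) = 0, the reflection in α fixes the sum of P. Evaluated where all positive roots are
positive, this contradicts the sign -1 that the reflection puts on α, since no sign exceeds 1. -/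
theorem dualInner_rho_ne_zero {α : Module.Dual ℝ h} (hα : α ∈ P) :
    B.dualInner h (rho P) α ≠ 0 := by
  obtain ⟨σ, ε, hσP, hσσ, hεσ, hr, hε1, hεα, -⟩ := hP.exists_signed_perm hα
  obtain ⟨x, hx⟩ := hP.exists_pos
  intro h0
  rw [dualInner, form_dualVec, rho, LinearMap.smul_apply, smul_eq_zero] at h0
  replace h0 := h0.resolve_left (by norm_num)
  have h1 : B.reflect α (∑ β ∈ P, β) = ∑ β ∈ P, β := by
    rw [reflect_apply, h0, mul_zero, zero_div, zero_smul, sub_zero]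
  have h2 : ∑ β ∈ P, ε β * β x = ∑ β ∈ P, β x := by
    have h3 := congrArg (fun ξ => ξ x) h1
    simp only [map_sum, LinearMap.sum_apply] at h3
    rw [← h3]
    refine Finset.sum_nbij' σ σ hσP hσP hσσ hσσ fun β hβ => ?_
    rw [hr _ (hσP β hβ), hσσ β hβ, hεσ β hβ]
    rfl
  have h3 : ∑ β ∈ P, ε β * β x < ∑ β ∈ P, β x := by
    refine Finset.sum_lt_sum (fun β hβ => ?_) ⟨α, hα, ?_⟩
    · nlinarith [hε1 β hβ, hx β hβ]
    · rw [hεα]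
      linarith [hx α hα]
  exact h3.ne h2

theorem rootProd_ne_zero : B.rootProd P ≠ 0 := by
  rw [rootProd, Finset.prod_ne_zero_iff]
  intro α hα
  rw [Ne, ι_eq_zero_iff, LinearEquiv.map_eq_zero_iff]
  exact hP.ne_zero hα

theorem exists_weylD_eq : ∃ k : ℝ, k ≠ 0 ∧ B.weylD h P = k • B.rootProd P := by
  refine ⟨∏ α ∈ P, (B.dualInner h (rho P) α)⁻¹, ?_, ?_⟩
  · exact Finset.prod_ne_zero_iff.2 fun α hα => inv_ne_zero (hP.dualInner_rho_ne_zero hα)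
  · rw [weylD, rootProd, Algebra.smul_def, map_prod, ← Finset.prod_mul_distrib]
    exact Finset.prod_congr rfl fun α _ => Algebra.smul_def _ _

end IsReducedPositiveSystem

end InvariantInnerProduct

/-! ### Existence of orthonormal bases -/

section OrthonormalBasis

variable {V : Type*} [AddCommGroup V] [Module ℝ V] [FiniteDimensional ℝ V]

theorem exists_isOrthonormalBasis (b : LinearMap.BilinForm ℝ V) (hb : ∀ x y, b x y = b y x)
    (hpos : ∀ x, x ≠ 0 → 0 < b x x) :
    ∃ e : Module.Basis (Fin (Module.finrank ℝ V)) ℝ V, IsOrthonormalBasis b e := by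
  obtain ⟨v, hv⟩ := LinearMap.BilinForm.exists_orthogonal_basis (B := b) ⟨fun x y => hb x y⟩
  have hvpos : ∀ i, 0 < b (v i) (v i) := fun i => hpos _ (v.ne_zero i)
  have hu : ∀ i, IsUnit ((√(b (v i) (v i)))⁻¹) := fun i =>
    isUnit_iff_ne_zero.2 (inv_ne_zero (Real.sqrt_pos.2 (hvpos i)).ne')
  refine ⟨v.isUnitSMul hu, fun i => ?_, fun i j hij => ?_⟩
  · rw [Module.Basis.isUnitSMul_apply, map_smul, map_smul, LinearMap.smul_apply, smul_eq_mul,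
      smul_eq_mul]
    nth_rewrite 3 [← Real.mul_self_sqrt (hvpos i).le]
    have := (Real.sqrt_pos.2 (hvpos i)).ne'
    field_simp
  · rw [Module.Basis.isUnitSMul_apply, Module.Basis.isUnitSMul_apply, map_smul, map_smul,
      LinearMap.smul_apply]
    have : b (v i) (v j) = 0 := hv hij
    rw [this, smul_zero, smul_zero]

end OrthonormalBasis

/-! ### Complexification of the Lie algebra and its Cartan subalgebra -/

section Complexification

variable {g : Type*} [LieRing g] [LieAlgebra ℝ g]

/-- The real part `ℂ ⊗ g → g`. -/
def rePart : ℂ ⊗[ℝ] g →ₗ[ℝ] g := (TensorProduct.lid ℝ g).toLinearMap ∘ₗ Complex.reLm.rTensor g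

/-- The imaginary part `ℂ ⊗ g → g`. -/
def imPart : ℂ ⊗[ℝ] g →ₗ[ℝ] g := (TensorProduct.lid ℝ g).toLinearMap ∘ₗ Complex.imLm.rTensor g

@[simp] theorem rePart_tmul (c : ℂ) (x : g) : rePart (c ⊗ₜ[ℝ] x) = c.re • x := by
  simp [rePart]

@[simp] theorem imPart_tmul (c : ℂ) (x : g) : imPart (c ⊗ₜ[ℝ] x) = c.im • x := by
  simp [imPart]

theorem tmul_rePart_add (z : ℂ ⊗[ℝ] g) :
    (1 : ℂ) ⊗ₜ[ℝ] rePart z + Complex.I ⊗ₜ[ℝ] imPart z = z := by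
  induction z using TensorProduct.induction_on with
  | zero => simp
  | tmul c x =>
    rw [rePart_tmul, imPart_tmul, ← TensorProduct.smul_tmul, ← TensorProduct.smul_tmul,
      ← TensorProduct.add_tmul]
    congr 1
    apply Complex.ext <;> simp
  | add z w hz hw =>
    rw [map_add, map_add, TensorProduct.tmul_add, TensorProduct.tmul_add, add_add_add_comm, hz, hw]

theorem complexification_ext {z w : ℂ ⊗[ℝ] g} (h1 : rePart z = rePart w)
    (h2 : imPart z = imPart w) : z = w := by
  rw [← tmul_rePart_add z, ← tmul_rePart_add w, h1, h2]

theorem rePart_smul (c : ℂ) (z : ℂ ⊗[ℝ] g) :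
    rePart (c • z) = c.re • rePart z - c.im • imPart z := by
  conv_lhs => rw [← tmul_rePart_add z]
  simp [TensorProduct.smul_tmul', sub_eq_add_neg]

theorem imPart_smul (c : ℂ) (z : ℂ ⊗[ℝ] g) :
    imPart (c • z) = c.im • rePart z + c.re • imPart z := by
  conv_lhs => rw [← tmul_rePart_add z]
  simp [TensorProduct.smul_tmul']

theorem rePart_lie (z w : ℂ ⊗[ℝ] g) :
    rePart ⁅z, w⁆ = ⁅rePart z, rePart w⁆ - ⁅imPart z, imPart w⁆ := by
  conv_lhs => rw [← tmul_rePart_add z, ← tmul_rePart_add w]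
  simp [sub_eq_add_neg]

theorem imPart_lie (z w : ℂ ⊗[ℝ] g) :
    imPart ⁅z, w⁆ = ⁅rePart z, imPart w⁆ + ⁅imPart z, rePart w⁆ := by
  conv_lhs => rw [← tmul_rePart_add z, ← tmul_rePart_add w]
  simp [add_comm]

/-- The complex conjugation of `ℂ ⊗ g`. -/
def conjPart (z : ℂ ⊗[ℝ] g) : ℂ ⊗[ℝ] g :=
  (1 : ℂ) ⊗ₜ[ℝ] rePart z - Complex.I ⊗ₜ[ℝ] imPart z

@[simp] theorem rePart_conjPart (z : ℂ ⊗[ℝ] g) : rePart (conjPart z) = rePart z := by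
  simp [conjPart]

@[simp] theorem imPart_conjPart (z : ℂ ⊗[ℝ] g) : imPart (conjPart z) = -imPart z := by
  simp [conjPart]

/-- The complexification of a subspace. -/
def complexify (W : Submodule ℝ g) : Submodule ℂ (ℂ ⊗[ℝ] g) where
  carrier := {z | rePart z ∈ W ∧ imPart z ∈ W}
  add_mem' := fun ha hb => by
    simpa using ⟨W.add_mem ha.1 hb.1, W.add_mem ha.2 hb.2⟩
  zero_mem' := by simp
  smul_mem' := fun c z hz => by
    refine ⟨?_, ?_⟩
    · rw [rePart_smul]
      exact W.sub_mem (W.smul_mem _ hz.1) (W.smul_mem _ hz.2)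
    · rw [imPart_smul]
      exact W.add_mem (W.smul_mem _ hz.1) (W.smul_mem _ hz.2)

theorem mem_complexify {W : Submodule ℝ g} {z : ℂ ⊗[ℝ] g} :
    z ∈ complexify W ↔ rePart z ∈ W ∧ imPart z ∈ W := Iff.rfl

/-- The complexification of a Lie subalgebra. -/
def complexCartan (h : LieSubalgebra ℝ g) : LieSubalgebra ℂ (ℂ ⊗[ℝ] g) where
  __ := complexify h.toSubmodule
  lie_mem' := fun {z w} hz hw => by
    change _ ∈ complexify h.toSubmodule
    rw [mem_complexify, rePart_lie, imPart_lie]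
    exact ⟨h.sub_mem (h.lie_mem hz.1 hw.1) (h.lie_mem hz.2 hw.2),
      h.add_mem (h.lie_mem hz.1 hw.2) (h.lie_mem hz.2 hw.1)⟩

theorem mem_complexCartan {h : LieSubalgebra ℝ g} {z : ℂ ⊗[ℝ] g} :
    z ∈ complexCartan h ↔ rePart z ∈ h ∧ imPart z ∈ h := Iff.rfl

theorem one_tmul_mem_complexCartan {h : LieSubalgebra ℝ g} (x : h) :
    (1 : ℂ) ⊗ₜ[ℝ] (x : g) ∈ complexCartan h := by
  rw [mem_complexCartan]; simp

/-- On g the complex Killing form takes the values of the real one, so the real and imaginary parts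
of a vector in its radical lie in the real radical. -/
theorem isKilling_complexification [FiniteDimensional ℝ g] [LieAlgebra.IsKilling ℝ g] :
    LieAlgebra.IsKilling ℂ (ℂ ⊗[ℝ] g) where
  killingCompl_top_eq_bot := by
    rw [eq_bot_iff]
    intro z hz
    rw [LieIdeal.mem_killingCompl] at hz
    have h1 : ∀ w a : g, killingForm ℂ (ℂ ⊗[ℝ] g) ((1 : ℂ) ⊗ₜ[ℝ] w) ((1 : ℂ) ⊗ₜ[ℝ] a) =
        (killingForm ℝ g w a : ℂ) := fun w a => by
      have := LieModule.traceForm_baseChange ℝ g g ℂ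
      rw [killingForm, this]
      simp
    have h2 : ∀ a : g, Complex.I ⊗ₜ[ℝ] a = Complex.I • ((1 : ℂ) ⊗ₜ[ℝ] a) := fun a => by
      simp [TensorProduct.smul_tmul']
    have h3 : ∀ w : g, killingForm ℝ g w (rePart z) = 0 ∧ killingForm ℝ g w (imPart z) = 0 := by
      intro w
      have := hz ((1 : ℂ) ⊗ₜ[ℝ] w) (by simp)
      rw [← tmul_rePart_add z, h2, map_add, map_smul, h1, h1] at this
      have hre := congrArg Complex.re this
      have him := congrArg Complex.im this
      simp at hre him
      exact ⟨hre, him⟩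
    have h4 := (LieAlgebra.IsKilling.killingForm_nondegenerate ℝ g).2
    rw [LieSubmodule.mem_bot]
    refine complexification_ext ?_ ?_
    · rw [map_zero]; exact h4 _ fun w => (h3 w).1
    · rw [map_zero]; exact h4 _ fun w => (h3 w).2

variable {h : LieSubalgebra ℝ g}

/-- The centralizer of h lies in its normalizer, which is h. -/
theorem mem_of_lie_eq_zero [h.IsCartanSubalgebra] {w : g} (hw : ∀ x : h, ⁅(x : g), w⁆ = 0) :
    w ∈ h := by
  rw [← LieSubalgebra.IsCartanSubalgebra.self_normalizing (H := h),
    LieSubalgebra.mem_normalizer_iff]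
  intro x hx
  rw [← lie_skew, hw ⟨x, hx⟩, neg_zero]
  exact h.zero_mem

theorem lie_eq_zero_of_isLieAbelian [IsLieAbelian h] (x y : h) : ⁅(x : g), (y : g)⁆ = 0 := by
  rw [← LieSubalgebra.coe_bracket, trivial_lie_zero]
  rfl

theorem isLieAbelian_complexCartan [IsLieAbelian h] : IsLieAbelian (complexCartan h) where
  trivial := fun z w => by
    have hz := mem_complexCartan.1 z.2
    have hw := mem_complexCartan.1 w.2
    have h0 : ∀ {x y : g}, x ∈ h → y ∈ h → ⁅x, y⁆ = 0 := fun {x y} hx hy =>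
      lie_eq_zero_of_isLieAbelian (⟨x, hx⟩ : h) ⟨y, hy⟩
    refine Subtype.ext (complexification_ext ?_ ?_)
    · rw [LieSubalgebra.coe_bracket, rePart_lie, h0 hz.1 hw.1, h0 hz.2 hw.2]
      simp
    · rw [LieSubalgebra.coe_bracket, imPart_lie, h0 hz.1 hw.2, h0 hz.2 hw.1]
      simp

theorem isCartanSubalgebra_complexCartan [h.IsCartanSubalgebra] [IsLieAbelian h] :
    (complexCartan h).IsCartanSubalgebra where
  nilpotent := by
    have := isLieAbelian_complexCartan (h := h)
    infer_instance
  self_normalizing := by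
    refine le_antisymm (fun z hz => ?_) (LieSubalgebra.le_normalizer _)
    rw [LieSubalgebra.mem_normalizer_iff] at hz
    have h1 : ∀ x ∈ h, ⁅rePart z, x⁆ ∈ h ∧ ⁅imPart z, x⁆ ∈ h := fun x hx => by
      have := mem_complexCartan.1 (hz _ (one_tmul_mem_complexCartan ⟨x, hx⟩))
      rw [rePart_lie, imPart_lie] at this
      simpa using this
    rw [mem_complexCartan, ← LieSubalgebra.IsCartanSubalgebra.self_normalizing (H := h),
      LieSubalgebra.mem_normalizer_iff, LieSubalgebra.mem_normalizer_iff]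
    exact ⟨fun x hx => (h1 x hx).1, fun x hx => (h1 x hx).2⟩

end Complexification

/-! ### Nondegeneracy of the Killing form -/

namespace InvariantInnerProduct

variable {g : Type*} [LieRing g] [LieAlgebra ℝ g] (B : InvariantInnerProduct g)

theorem form_lie_self (x y : g) : B.form ⁅x, y⁆ y = 0 := by
  have := B.invariant x y y
  rw [B.symm y] at this
  linarith

theorem form_self_nonneg (x : g) : 0 ≤ B.form x x := by
  rcases eq_or_ne x 0 with rfl | hx
  · simp
  · exact (B.pos x hx).le

theorem form_self_eq_zero {x : g} : B.form x x = 0 ↔ x = 0 :=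
  ⟨fun hx => by_contra fun h0 => (B.pos x h0).ne' hx, fun hx => by simp [hx]⟩

include B in
/-- The Killing form is definite when an invariant inner product exists and the center is
trivial. -/
theorem isKilling [FiniteDimensional ℝ g] (hc : LieAlgebra.center ℝ g = ⊥) :
    LieAlgebra.IsKilling ℝ g where
  killingCompl_top_eq_bot := by
    rw [eq_bot_iff]
    intro x hx
    rw [LieIdeal.mem_killingCompl] at hx
    obtain ⟨e, he⟩ := exists_isOrthonormalBasis B.form B.symm B.pos
    -- Since ad x is skew, the trace of (ad x)² is minus a sum of squared norms.
    have h1 : killingForm ℝ g x x = -∑ i, B.form ⁅x, e i⁆ ⁅x, e i⁆ := by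
      rw [killingForm_apply_apply, LinearMap.trace_eq_matrix_trace ℝ e, Matrix.trace,
        ← Finset.sum_neg_distrib]
      refine Finset.sum_congr rfl fun i _ => ?_
      rw [Matrix.diag_apply, LinearMap.toMatrix_apply, ← Module.Basis.coord_apply,
        ← he.form_eq_coord, LinearMap.comp_apply, LieAlgebra.ad_apply, LieAlgebra.ad_apply,
        B.invariant x (e i), neg_neg]
    rw [hx x (by simp), zero_eq_neg,
      Finset.sum_eq_zero_iff_of_nonneg fun i _ => B.form_self_nonneg _] at h1
    have h2 : LieAlgebra.ad ℝ g x = 0 := e.ext fun i => by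
      simpa using B.form_self_eq_zero.1 (h1 i (Finset.mem_univ i))
    rw [← hc, LieModule.mem_maxTrivSubmodule]
    intro y
    rw [← lie_skew, ← LieAlgebra.ad_apply (R := ℝ), h2]
    simp

end InvariantInnerProduct

open LieAlgebra LieModule

/-! ### Real roots and weights of the complexified pair -/

section Weights

variable {g : Type*} [LieRing g] [LieAlgebra ℝ g] {h : LieSubalgebra ℝ g}

/-- The complex linear functional on the complexified Cartan subalgebra that is `√-1 β` on `h`. -/
def rootFunction (β : Module.Dual ℝ h) (y : complexCartan h) : ℂ :=
  Complex.I * (β ⟨rePart (y : ℂ ⊗[ℝ] g), (mem_complexCartan.1 y.2).1⟩ +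
    Complex.I * β ⟨imPart (y : ℂ ⊗[ℝ] g), (mem_complexCartan.1 y.2).2⟩)

theorem rootFunction_one_tmul (β : Module.Dual ℝ h) (x : h) :
    rootFunction β ⟨(1 : ℂ) ⊗ₜ[ℝ] (x : g), one_tmul_mem_complexCartan x⟩ = Complex.I * β x := by
  have h1 : (⟨rePart ((1 : ℂ) ⊗ₜ[ℝ] (x : g)), by simp⟩ : h) = x := Subtype.ext (by simp)
  have h2 : (⟨imPart ((1 : ℂ) ⊗ₜ[ℝ] (x : g)), by simp⟩ : h) = 0 := Subtype.ext (by simp)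
  change Complex.I * ((β ⟨rePart ((1 : ℂ) ⊗ₜ[ℝ] (x : g)), by simp⟩ : ℂ) +
    Complex.I * β ⟨imPart ((1 : ℂ) ⊗ₜ[ℝ] (x : g)), by simp⟩) = _
  rw [h1, h2, map_zero, Complex.ofReal_zero, mul_zero, add_zero]

theorem rootFunction_injective : Function.Injective (rootFunction (h := h)) := fun β γ hβγ => by
  ext x
  have := congrFun hβγ ⟨(1 : ℂ) ⊗ₜ[ℝ] (x : g), one_tmul_mem_complexCartan x⟩
  rw [rootFunction_one_tmul, rootFunction_one_tmul] at this
  simpa using this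

theorem rootFunction_neg (β : Module.Dual ℝ h) : rootFunction (-β) = -rootFunction β := by
  ext y
  simp [rootFunction]
  ring

theorem rootFunction_sub_smul (β α : Module.Dual ℝ h) (c : ℝ) :
    rootFunction (β - c • α) = rootFunction β - (c : ℂ) • rootFunction α := by
  ext y
  simp [rootFunction]
  ring

theorem rootFunction_smul (α : Module.Dual ℝ h) (c : ℝ) :
    rootFunction (c • α) = (c : ℂ) • rootFunction α := by
  ext y
  simp [rootFunction]
  ring

theorem rootFunction_zero : rootFunction (0 : Module.Dual ℝ h) = 0 := by
  ext y
  simp [rootFunction]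

theorem lie_eq_rootFunction_smul {β : Module.Dual ℝ h} {z : ℂ ⊗[ℝ] g}
    (hz : ∀ x : h, ⁅(1 : ℂ) ⊗ₜ[ℝ] (x : g), z⁆ = (Complex.I * (β x : ℂ)) • z)
    (y : complexCartan h) : ⁅(y : ℂ ⊗[ℝ] g), z⁆ = rootFunction β y • z := by
  have hy : (y : ℂ ⊗[ℝ] g) = (1 : ℂ) ⊗ₜ[ℝ] rePart (y : ℂ ⊗[ℝ] g) +
      Complex.I • ((1 : ℂ) ⊗ₜ[ℝ] imPart (y : ℂ ⊗[ℝ] g)) := by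
    conv_lhs => rw [← tmul_rePart_add (y : ℂ ⊗[ℝ] g)]
    simp [TensorProduct.smul_tmul']
  have hI : ∀ a : ℂ ⊗[ℝ] g, ⁅Complex.I • a, z⁆ = Complex.I • ⁅a, z⁆ := fun a =>
    complexification_ext
      (by
        simp only [rePart_lie, rePart_smul, imPart_lie, imPart_smul, Complex.I_re, Complex.I_im,
          zero_smul, one_smul, zero_sub, add_zero, neg_lie]
        abel)
      (by
        simp only [rePart_lie, rePart_smul, imPart_lie, imPart_smul, Complex.I_re, Complex.I_im,
          zero_smul, one_smul, zero_sub, add_zero, neg_lie]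
        abel)
  conv_lhs => rw [hy]
  rw [add_lie, hI, hz ⟨_, (mem_complexCartan.1 y.2).1⟩,
    hz ⟨_, (mem_complexCartan.1 y.2).2⟩, smul_smul, ← add_smul, rootFunction]
  congr 1
  ring

variable [FiniteDimensional ℝ g] [IsKilling ℂ (ℂ ⊗[ℝ] g)] [(complexCartan h).IsCartanSubalgebra]

/-- Root spaces are generalized weight spaces; with a nondegenerate Killing form they consist of
true eigenvectors, and an eigenvalue is determined by its values on h. -/
theorem mem_rootSpace_iff {β : Module.Dual ℝ h} {z : ℂ ⊗[ℝ] g} :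
    z ∈ rootSpace (complexCartan h) (rootFunction β) ↔
      ∀ x : h, ⁅(1 : ℂ) ⊗ₜ[ℝ] (x : g), z⁆ = (Complex.I * (β x : ℂ)) • z := by
  constructor
  · intro hz x
    have := IsKilling.lie_eq_smul_of_mem_rootSpace hz
      ⟨(1 : ℂ) ⊗ₜ[ℝ] (x : g), one_tmul_mem_complexCartan x⟩
    rwa [rootFunction_one_tmul] at this
  · intro hz
    rw [mem_genWeightSpace]
    intro y
    refine ⟨1, ?_⟩
    have := lie_eq_rootFunction_smul hz y
    simp only [pow_one, LinearMap.sub_apply, toEnd_apply_apply, LinearMap.smul_apply,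
      Module.End.one_apply]
    exact sub_eq_zero.2 this

theorem mem_realRoots_iff {β : Module.Dual ℝ h} :
    β ∈ realRoots h ↔ β ≠ 0 ∧ rootSpace (complexCartan h) (rootFunction β) ≠ ⊥ := by
  refine and_congr_right fun _ => ?_
  rw [Ne, LieSubmodule.eq_bot_iff]
  push Not
  exact exists_congr fun z => by rw [mem_rootSpace_iff, and_comm]

theorem mem_rootSpace_iff_parts {β : Module.Dual ℝ h} {z : ℂ ⊗[ℝ] g} :
    z ∈ rootSpace (complexCartan h) (rootFunction β) ↔
      ∀ x : h, ⁅(x : g), rePart z⁆ = -(β x • imPart z) ∧ ⁅(x : g), imPart z⁆ = β x • rePart z := by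
  rw [mem_rootSpace_iff]
  refine forall_congr' fun x => ?_
  have h1 : rePart ⁅(1 : ℂ) ⊗ₜ[ℝ] (x : g), z⁆ = ⁅(x : g), rePart z⁆ := by simp [rePart_lie]
  have h2 : imPart ⁅(1 : ℂ) ⊗ₜ[ℝ] (x : g), z⁆ = ⁅(x : g), imPart z⁆ := by simp [imPart_lie]
  have h3 : rePart ((Complex.I * (β x : ℂ)) • z) = -(β x • imPart z) := by simp [rePart_smul]
  have h4 : imPart ((Complex.I * (β x : ℂ)) • z) = β x • rePart z := by simp [imPart_smul]
  rw [← h1, ← h2, ← h3, ← h4]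
  exact ⟨fun h => by rw [h]; exact ⟨rfl, rfl⟩, fun h => complexification_ext h.1 h.2⟩

/-- Conjugation exchanges the root spaces of β and -β, so the positive roots already account for all
real root planes. -/
theorem conjPart_mem_rootSpace {β : Module.Dual ℝ h} {z : ℂ ⊗[ℝ] g}
    (hz : z ∈ rootSpace (complexCartan h) (rootFunction β)) :
    conjPart z ∈ rootSpace (complexCartan h) (rootFunction (-β)) := by
  rw [mem_rootSpace_iff_parts] at hz ⊢
  intro x
  rw [rePart_conjPart, imPart_conjPart, lie_neg, (hz x).1, (hz x).2]
  simp

theorem neg_mem_realRoots {β : Module.Dual ℝ h} (hβ : β ∈ realRoots h) : -β ∈ realRoots h := by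
  obtain ⟨h0, z, hz0, hz⟩ := hβ
  refine ⟨neg_ne_zero.2 h0, conjPart z, fun h1 => hz0 ?_,
    mem_rootSpace_iff.1 (conjPart_mem_rootSpace (mem_rootSpace_iff.2 hz))⟩
  refine complexification_ext ?_ ?_
  · simpa using congrArg rePart h1
  · simpa using congrArg imPart h1

/-- The weight of the complexified pair that corresponds to a real root. -/
def weightOfRealRoot {β : Module.Dual ℝ h} (hβ : β ∈ realRoots h) :
    Weight ℂ (complexCartan h) (ℂ ⊗[ℝ] g) :=
  ⟨rootFunction β, (mem_realRoots_iff.1 hβ).2⟩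

theorem coe_weightOfRealRoot {β : Module.Dual ℝ h} (hβ : β ∈ realRoots h) :
    (weightOfRealRoot hβ : complexCartan h → ℂ) = rootFunction β := rfl

theorem weightOfRealRoot_isNonZero {β : Module.Dual ℝ h} (hβ : β ∈ realRoots h) :
    (weightOfRealRoot hβ).IsNonZero := fun h0 => hβ.1 <| by
  apply rootFunction_injective
  rw [rootFunction_zero]
  exact h0

theorem exists_smul_of_mem_rootSpace {β : Module.Dual ℝ h} (hβ : β ∈ realRoots h)
    {z w : ℂ ⊗[ℝ] g} (hz : z ∈ rootSpace (complexCartan h) (rootFunction β)) (hz0 : z ≠ 0)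
    (hw : w ∈ rootSpace (complexCartan h) (rootFunction β)) : ∃ c : ℂ, w = c • z := by
  have h1 := IsKilling.finrank_rootSpace_eq_one _ (weightOfRealRoot_isNonZero hβ)
  obtain ⟨c, hc⟩ := (finrank_eq_one_iff_of_nonzero' (⟨z, hz⟩ :
    rootSpace (complexCartan h) (weightOfRealRoot hβ)) (fun h0 => hz0 (congrArg Subtype.val h0))).1
    h1 ⟨w, hw⟩
  exact ⟨c, (congrArg Subtype.val hc).symm⟩

theorem eq_or_eq_neg_of_smul {α β : Module.Dual ℝ h} (hα : α ∈ realRoots h)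
    (hβ : β ∈ realRoots h) {c : ℝ} (hc : β = c • α) : β = -α ∨ β = α := by
  have h1 := IsKilling.eq_neg_or_eq_of_eq_smul (weightOfRealRoot hα) (weightOfRealRoot hβ)
    (weightOfRealRoot_isNonZero hβ) (c : ℂ) (by
      rw [coe_weightOfRealRoot, coe_weightOfRealRoot, hc, rootFunction_smul])
  refine h1.imp (fun h2 => rootFunction_injective ?_) (fun h2 => rootFunction_injective ?_)
  · have := congrArg (fun χ : Weight ℂ (complexCartan h) (ℂ ⊗[ℝ] g) =>
      (χ : complexCartan h → ℂ)) h2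
    rw [rootFunction_neg]
    exact this
  · exact congrArg (fun χ : Weight ℂ (complexCartan h) (ℂ ⊗[ℝ] g) =>
      (χ : complexCartan h → ℂ)) h2

/-- The invariant inner product forces all weights to be imaginary on `h`. -/
theorem exists_rootFunction_eq (B : InvariantInnerProduct g)
    (χ : Weight ℂ (complexCartan h) (ℂ ⊗[ℝ] g)) :
    ∃ β : Module.Dual ℝ h, (χ : complexCartan h → ℂ) = rootFunction β := by
  obtain ⟨z, hz, hz0⟩ := χ.exists_ne_zero
  have hlie := IsKilling.lie_eq_smul_of_mem_rootSpace hz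
  let j : h → complexCartan h := fun x => ⟨(1 : ℂ) ⊗ₜ[ℝ] (x : g), one_tmul_mem_complexCartan x⟩
  have hχ : ∀ x, (χ (j x)).re = 0 := by
    intro x
    have h0 : ⁅(1 : ℂ) ⊗ₜ[ℝ] (x : g), z⁆ = χ (j x) • z := hlie (j x)
    have h1 : ⁅(x : g), rePart z⁆ = (χ (j x)).re • rePart z - (χ (j x)).im • imPart z := by
      rw [← rePart_smul, ← h0]; simp [rePart_lie]
    have h2 : ⁅(x : g), imPart z⁆ = (χ (j x)).im • rePart z + (χ (j x)).re • imPart z := by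
      rw [← imPart_smul, ← h0]; simp [imPart_lie]
    have h3 := B.form_lie_self x (rePart z)
    have h4 := B.form_lie_self x (imPart z)
    rw [h1] at h3
    rw [h2] at h4
    simp only [map_sub, map_add, map_smul, LinearMap.sub_apply, LinearMap.add_apply,
      LinearMap.smul_apply, smul_eq_mul] at h3 h4
    rw [B.symm (imPart z) (rePart z)] at h3
    -- Adding `h3` and `h4` cancels the mixed terms: skewness of ad x forces the real part of the
    -- eigenvalue to vanish.
    have h5 : (χ (j x)).re * (B.form (rePart z) (rePart z) + B.form (imPart z) (imPart z)) = 0 := by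
      linarith
    refine (mul_eq_zero.1 h5).resolve_right fun h6 => hz0 ?_
    have h7 := B.form_self_nonneg (rePart z)
    have h8 := B.form_self_nonneg (imPart z)
    refine complexification_ext ?_ ?_
    · rw [map_zero, ← B.form_self_eq_zero]; linarith
    · rw [map_zero, ← B.form_self_eq_zero]; linarith
  let χ' := Weight.toLinear ℂ (complexCartan h) (ℂ ⊗[ℝ] g) χ
  have hj_add : ∀ x y, j (x + y) = j x + j y := fun x y =>
    Subtype.ext (by simp [j, TensorProduct.tmul_add])
  have hj_smul : ∀ (c : ℝ) x, j (c • x) = (c : ℂ) • j x := fun c x =>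
    Subtype.ext (by simp [j, TensorProduct.smul_tmul'])
  let β : Module.Dual ℝ h :=
    { toFun := fun x => (χ' (j x)).im
      map_add' := fun x y => by rw [hj_add, map_add, Complex.add_im]
      map_smul' := fun c x => by rw [hj_smul, map_smul]; simp }
  refine ⟨β, ?_⟩
  ext y
  have hI : ∀ x : h, χ (j x) = Complex.I * β x := fun x => by
    apply Complex.ext
    · simp [hχ]
    · simp [β, χ']
  have h9 := lie_eq_rootFunction_smul (β := β) (z := z) (fun x => by rw [← hI]; exact hlie (j x)) y
  have h10 : ⁅(y : ℂ ⊗[ℝ] g), z⁆ = χ y • z := hlie y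
  rw [h10] at h9
  exact smul_left_injective ℂ hz0 h9

end Weights

/-! ### Real root planes, root frames and reflections of roots -/

namespace InvariantInnerProduct

variable {g : Type*} [LieRing g] [LieAlgebra ℝ g] (B : InvariantInnerProduct g)
  {h : LieSubalgebra ℝ g}

/-- `u, v` span a real root plane for `α`. -/
def IsRootPair (α : Module.Dual ℝ h) (u v : g) : Prop :=
  ∀ x : h, ⁅(x : g), u⁆ = α x • v ∧ ⁅(x : g), v⁆ = -(α x • u)

namespace IsRootPair

variable {B} {α β : Module.Dual ℝ h} {u v u' v' : g}

theorem form_eq_form (huv : IsRootPair α u v) (hα : α ≠ 0) :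
    B.form u u = B.form v v ∧ B.form u v = 0 := by
  obtain ⟨x, hx⟩ := DFunLike.ne_iff.1 hα
  rw [LinearMap.zero_apply] at hx
  have h1 := B.invariant x u v
  have h2 := B.form_lie_self x u
  rw [(huv x).1, (huv x).2] at h1
  rw [(huv x).1] at h2
  simp only [map_smul, map_neg, LinearMap.smul_apply, smul_eq_mul, neg_neg] at h1 h2
  exact ⟨(mul_left_cancel₀ hx h1).symm,
    by rw [B.symm]; exact (mul_eq_zero.1 h2).resolve_left hx⟩

theorem form_eq_zero_of_mem [IsLieAbelian h] (huv : IsRootPair α u v) (hα : α ≠ 0) (y : h) :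
    B.form u y = 0 ∧ B.form v y = 0 := by
  obtain ⟨x, hx⟩ := DFunLike.ne_iff.1 hα
  rw [LinearMap.zero_apply] at hx
  have h1 := B.invariant x u y
  have h2 := B.invariant x v y
  rw [(huv x).1, lie_eq_zero_of_isLieAbelian] at h1
  rw [(huv x).2, lie_eq_zero_of_isLieAbelian] at h2
  simp only [map_smul, map_neg, map_zero, neg_zero, LinearMap.smul_apply, LinearMap.neg_apply,
    smul_eq_mul, neg_eq_zero] at h1 h2
  exact ⟨(mul_eq_zero.1 h2).resolve_left hx, (mul_eq_zero.1 h1).resolve_left hx⟩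

/-- The operator (ad x)² is self-adjoint and acts on the two planes by -α(x)² and -β(x)²; distinct
eigenvalues force orthogonality. -/
theorem form_eq_zero_of_sq_ne (huv : IsRootPair α u v) (huv' : IsRootPair β u' v') {x : h}
    (hx : α x ^ 2 ≠ β x ^ 2) : B.form u u' = 0 ∧ B.form u v' = 0 ∧ B.form v u' = 0 ∧
      B.form v v' = 0 := by
  have h1 := B.invariant x u u'
  have h2 := B.invariant x u v'
  have h3 := B.invariant x v u'
  have h4 := B.invariant x v v'
  rw [(huv x).1, (huv' x).1] at h1
  rw [(huv x).1, (huv' x).2] at h2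
  rw [(huv x).2, (huv' x).1] at h3
  rw [(huv x).2, (huv' x).2] at h4
  simp only [map_smul, map_neg, LinearMap.smul_apply, LinearMap.neg_apply, smul_eq_mul, neg_neg]
    at h1 h2 h3 h4
  have hx' : α x ^ 2 - β x ^ 2 ≠ 0 := sub_ne_zero.2 hx
  refine ⟨?_, ?_, ?_, ?_⟩ <;>
    refine (mul_eq_zero.1 (?_ : (α x ^ 2 - β x ^ 2) * _ = 0)).resolve_left hx'
  · linear_combination (-α x) * h3 + β x * h2
  · linear_combination (-α x) * h4 - β x * h1
  · linear_combination α x * h1 + β x * h4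
  · linear_combination α x * h2 - β x * h3

theorem smul (huv : IsRootPair α u v) (c : ℝ) : IsRootPair α (c • u) (c • v) := fun x => by
  rw [lie_smul, lie_smul, (huv x).1, (huv x).2, smul_neg, smul_comm, smul_comm c]
  exact ⟨rfl, rfl⟩

/-- By the Jacobi identity [u, v] commutes with h, hence lies in h; invariance and |v| = 1 identify
its pairing with x as α(x). -/
theorem lie_eq_dualVec [FiniteDimensional ℝ g] [h.IsCartanSubalgebra] (huv : IsRootPair α u v)
    (hv : B.form v v = 1) :
    ⁅u, v⁆ = B.dualVec h α := by
  have hmem : ⁅u, v⁆ ∈ h := mem_of_lie_eq_zero fun x => by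
    rw [leibniz_lie, (huv x).1, (huv x).2]
    simp
  have := B.eq_dualVec_of_form_eq (α := α) (y := ⟨⁅u, v⁆, hmem⟩) fun x => by
    change B.form ⁅u, v⁆ x = α x
    rw [B.invariant u v x, ← lie_skew, (huv x).1, map_neg, neg_neg, map_smul, hv, smul_eq_mul,
      mul_one]
  rw [← this]

end IsRootPair

variable [FiniteDimensional ℝ g]

/-- The imaginary and real parts of a root vector are orthogonal of equal length, and are divided by
that length. -/
theorem exists_isRootPair [IsKilling ℂ (ℂ ⊗[ℝ] g)] [(complexCartan h).IsCartanSubalgebra]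
    {α : Module.Dual ℝ h} (hα : α ∈ realRoots h) :
    ∃ u v : g, IsRootPair α u v ∧ B.form u u = 1 ∧ B.form v v = 1 ∧ B.form u v = 0 := by
  obtain ⟨hα0, z, hz0, hz⟩ := hα
  have h1 := mem_rootSpace_iff_parts.1 (mem_rootSpace_iff.2 hz)
  have h2 : IsRootPair α (imPart z) (rePart z) := fun x => ⟨(h1 x).2, (h1 x).1⟩
  obtain ⟨h3, h4⟩ := h2.form_eq_form (B := B) hα0
  have hpos : 0 < B.form (rePart z) (rePart z) := by
    refine lt_of_le_of_ne (B.form_self_nonneg _) fun h5 => hz0 ?_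
    refine complexification_ext ?_ ?_
    · rw [map_zero, ← B.form_self_eq_zero, ← h5]
    · rw [map_zero, ← B.form_self_eq_zero, h3, ← h5]
  set r := √(B.form (rePart z) (rePart z)) with hr
  have hr0 : r ≠ 0 := (Real.sqrt_pos.2 hpos).ne'
  have hrr : r * r = B.form (rePart z) (rePart z) := Real.mul_self_sqrt hpos.le
  refine ⟨r⁻¹ • imPart z, r⁻¹ • rePart z, h2.smul _, ?_, ?_, ?_⟩
  · simp only [map_smul, LinearMap.smul_apply, smul_eq_mul, h3, ← hrr]
    field_simp
  · simp only [map_smul, LinearMap.smul_apply, smul_eq_mul, ← hrr]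
    field_simp
  · simp [h4]

variable {P : Finset (Module.Dual ℝ h)}

theorem _root_.CompactLie.IsPositiveSystem.mem_or_neg_mem (hP : IsPositiveSystem h P)
    [IsKilling ℂ (ℂ ⊗[ℝ] g)] [(complexCartan h).IsCartanSubalgebra] {β : Module.Dual ℝ h}
    (hβ : β ∈ realRoots h) : β ∈ P ∨ -β ∈ P := by
  obtain ⟨x, hx, hP⟩ := hP
  rcases lt_or_gt_of_ne (hx β hβ) with h1 | h1
  · exact Or.inr ((hP _).2 ⟨neg_mem_realRoots hβ, by rw [LinearMap.neg_apply]; linarith⟩)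
  · exact Or.inl ((hP _).2 ⟨hβ, h1⟩)

omit [FiniteDimensional ℝ g] in
-- Equality of squares everywhere would force α = ±β. The minus sign contradicts positivity at x₀;
-- the test points x₀, y and x₀ + y suffice.
theorem _root_.CompactLie.IsPositiveSystem.exists_sq_ne (hP : IsPositiveSystem h P)
    {α β : Module.Dual ℝ h} (hα : α ∈ P) (hβ : β ∈ P) (hαβ : α ≠ β) :
    ∃ x : h, α x ^ 2 ≠ β x ^ 2 := by
  obtain ⟨x₀, -, hP⟩ := hP
  have h1 := ((hP α).1 hα).2
  have h2 := ((hP β).1 hβ).2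
  by_contra! hne
  obtain ⟨y, hy⟩ := DFunLike.ne_iff.1 hαβ
  have h3 : α x₀ = β x₀ := by
    have := hne x₀
    nlinarith
  have h4 : α y = -β y := by
    have : (α y - β y) * (α y + β y) = 0 := by linear_combination hne y
    linarith [(mul_eq_zero.1 this).resolve_left (sub_ne_zero.2 hy)]
  have h5 := hne (x₀ + y)
  rw [map_add, map_add, h3, h4] at h5
  have h6 : β x₀ * β y = 0 := by nlinarith
  have h7 := (mul_eq_zero.1 h6).resolve_left h2.ne'
  rw [h4, h7] at hy
  simp at hy

/-- The Parseval identity says that T, the sum of the orthogonal projections to h and to the root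
planes, is the identity. Its fixed space W contains h and these planes by orthonormality. The
complexification of W therefore contains all weight spaces, and these span. -/
theorem exists_isRootFrame [h.IsCartanSubalgebra] [IsLieAbelian h] [IsKilling ℂ (ℂ ⊗[ℝ] g)]
    [(complexCartan h).IsCartanSubalgebra] (hP : IsPositiveSystem h P) :
    ∃ u v : Module.Dual ℝ h → g, B.IsRootFrame P u v := by
  classical
  have hroot : ∀ α ∈ P, α ∈ realRoots h := by
    obtain ⟨x, -, hx⟩ := hP
    exact fun α hα => ((hx α).1 hα).1
  have hex : ∀ α : Module.Dual ℝ h, ∃ u v : g, α ∈ P → IsRootPair α u v ∧ B.form u u = 1 ∧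
      B.form v v = 1 ∧ B.form u v = 0 := fun α => by
    by_cases hα : α ∈ P
    · obtain ⟨u, v, huv⟩ := B.exists_isRootPair (hroot α hα)
      exact ⟨u, v, fun _ => huv⟩
    · exact ⟨0, 0, fun h1 => absurd h1 hα⟩
  choose u v huv using hex
  refine ⟨u, v, fun α hα x => ((huv α hα).1 x).1, fun α hα x => ((huv α hα).1 x).2,
    fun α hα => (huv α hα).1.lie_eq_dualVec (huv α hα).2.2.1, ?_⟩
  let T : g →ₗ[ℝ] g := h.toSubmodule.subtype ∘ₗ B.proj h +
    ∑ α ∈ P, ((B.form (u α)).smulRight (u α) + (B.form (v α)).smulRight (v α))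
  have hT : ∀ w, T w = (B.proj h w : g) +
      ∑ α ∈ P, (B.form (u α) w • u α + B.form (v α) w • v α) := fun w => by
    simp [T, LinearMap.sum_apply]
  let W : Submodule ℝ g := LinearMap.eqLocus T LinearMap.id
  have hW : ∀ w, w ∈ W ↔ T w = w := fun w => Iff.rfl
  have hperp : ∀ α ∈ P, ∀ y : h, B.form (u α) y = 0 ∧ B.form (v α) y = 0 := fun α hα y =>
    (huv α hα).1.form_eq_zero_of_mem (hroot α hα).1 y
  have hproj : ∀ w : g, (∀ y : h, B.form w y = 0) → B.proj h w = 0 := fun w hw => by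
    rw [B.eq_dualVec_of_form_eq (α := 0) (y := B.proj h w) fun x => by
      rw [form_proj, hw, LinearMap.zero_apply], map_zero]
  have hWh : ∀ y ∈ h, y ∈ W := fun y hy => by
    rw [hW, hT, Finset.sum_eq_zero fun α hα => by
      rw [(hperp α hα ⟨y, hy⟩).1, (hperp α hα ⟨y, hy⟩).2, zero_smul, zero_smul, add_zero], add_zero]
    have h1 : B.proj h y = ⟨y, hy⟩ := by
      have h2 : ∀ x : h, B.restrict h (B.proj h y - ⟨y, hy⟩) x = 0 := fun x => by
        rw [map_sub, LinearMap.sub_apply, restrict_apply, restrict_apply, form_proj, sub_self]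
      exact sub_eq_zero.1 ((B.restrict_nondegenerate h).1 _ h2)
    rw [h1]
  have hWuv : ∀ β ∈ P, u β ∈ W ∧ v β ∈ W := fun β hβ => by
    obtain ⟨h0, h1, h2, h3⟩ := huv β hβ
    have h4 : ∀ α ∈ P, α ≠ β → _ := fun α hα hαβ =>
      (huv α hα).1.form_eq_zero_of_sq_ne (B := B) h0 (hP.exists_sq_ne hα hβ hαβ).choose_spec
    constructor
    · rw [hW, hT, hproj _ fun y => (hperp β hβ y).1, Finset.sum_eq_single_of_mem β hβ
        fun α hα hαβ => by
          obtain ⟨h5, h6, h7, h8⟩ := h4 α hα hαβ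
          rw [h5, h7, zero_smul, zero_smul, add_zero], h1, B.symm (v β), h3]
      simp
    · rw [hW, hT, hproj _ fun y => (hperp β hβ y).2, Finset.sum_eq_single_of_mem β hβ
        fun α hα hαβ => by
          obtain ⟨h5, h6, h7, h8⟩ := h4 α hα hαβ
          rw [h6, h8, zero_smul, zero_smul, add_zero], h2, h3]
      simp
  have hWP : ∀ β ∈ P, ∀ z ∈ rootSpace (complexCartan h) (rootFunction β),
      z ∈ complexify W := fun β hβ z hz => by
    obtain ⟨h0, h1, h2, h3⟩ := huv β hβ
    set z₀ : ℂ ⊗[ℝ] g := (1 : ℂ) ⊗ₜ[ℝ] v β + Complex.I ⊗ₜ[ℝ] u β with hz₀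
    have hre : rePart z₀ = v β := by simp [hz₀]
    have him : imPart z₀ = u β := by simp [hz₀]
    have h4 : z₀ ∈ rootSpace (complexCartan h) (rootFunction β) := by
      rw [mem_rootSpace_iff_parts, hre, him]
      exact fun x => ⟨(h0 x).2, (h0 x).1⟩
    have h5 : z₀ ≠ 0 := fun h6 => by
      rw [h6, map_zero] at hre
      rw [← hre] at h2
      simp at h2
    obtain ⟨c, rfl⟩ := exists_smul_of_mem_rootSpace (hroot β hβ) h4 h5 hz
    refine (complexify W).smul_mem c ?_
    rw [mem_complexify, hre, him]
    exact ⟨(hWuv β hβ).2, (hWuv β hβ).1⟩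
  have htop : ∀ χ : Weight ℂ (complexCartan h) (ℂ ⊗[ℝ] g),
      ((genWeightSpace (ℂ ⊗[ℝ] g) χ : LieSubmodule ℂ (complexCartan h) (ℂ ⊗[ℝ] g)) :
        Submodule ℂ (ℂ ⊗[ℝ] g)) ≤ complexify W := fun χ z hz => by
    obtain ⟨β, hβ⟩ := exists_rootFunction_eq B χ
    rw [hβ] at hz
    change z ∈ rootSpace (complexCartan h) (rootFunction β) at hz
    by_cases hβ0 : β = 0
    · subst hβ0
      rw [mem_rootSpace_iff_parts] at hz
      exact ⟨hWh _ (mem_of_lie_eq_zero fun x => by simpa using (hz x).1),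
        hWh _ (mem_of_lie_eq_zero fun x => by simpa using (hz x).2)⟩
    · have hβr : β ∈ realRoots h := mem_realRoots_iff.2
        ⟨hβ0, by rw [← hβ]; exact χ.genWeightSpace_ne_bot⟩
      -- A negative root is handled by conjugation, which preserves the complexification of W.
      rcases hP.mem_or_neg_mem hβr with h1 | h1
      · exact hWP β h1 z hz
      · have h2 := hWP _ h1 _ (conjPart_mem_rootSpace hz)
        rw [mem_complexify, rePart_conjPart, imPart_conjPart, neg_mem_iff] at h2
        exact h2
  intro w
  rw [← hT, ← hW]
  have h1 : (1 : ℂ) ⊗ₜ[ℝ] w ∈ complexify W := by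
    have h2 : (⊤ : Submodule ℂ (ℂ ⊗[ℝ] g)) ≤ complexify W := by
      rw [← LieSubmodule.top_toSubmodule (R := ℂ) (L := complexCartan h),
        ← iSup_genWeightSpace_eq_top' ℂ (complexCartan h) (ℂ ⊗[ℝ] g),
        LieSubmodule.iSup_toSubmodule]
      exact iSup_le htop
    exact h2 trivial
  simpa using (mem_complexify.1 h1).1

/-- The coroot of √-1 α is a real multiple of √-1 t_α, so the reflection of complex roots restricts
on h to the metric reflection `reflect`. -/
theorem reflect_mem_realRoots [h.IsCartanSubalgebra] [IsKilling ℂ (ℂ ⊗[ℝ] g)]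
    [(complexCartan h).IsCartanSubalgebra] {α β : Module.Dual ℝ h}
    (hα : α ∈ realRoots h) (hβ : β ∈ realRoots h) : B.reflect α β ∈ realRoots h := by
  obtain ⟨u, v, huv, -, hv, -⟩ := B.exists_isRootPair hα
  have huvt := huv.lie_eq_dualVec hv
  set t := B.dualVec h α with ht
  have htpos : 0 < α t := B.apply_dualVec_pos hα.1
  set z : ℂ ⊗[ℝ] g := (1 : ℂ) ⊗ₜ[ℝ] v + Complex.I ⊗ₜ[ℝ] u with hz
  have hre : rePart z = v := by simp [hz]
  have him : imPart z = u := by simp [hz]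
  have h4 : z ∈ rootSpace (complexCartan h) (rootFunction α) := by
    rw [mem_rootSpace_iff_parts, hre, him]
    exact fun x => ⟨(huv x).2, (huv x).1⟩
  let s : complexCartan h := ⟨Complex.I ⊗ₜ[ℝ] (t : g), by rw [mem_complexCartan]; simp⟩
  have hs : ∀ γ : Module.Dual ℝ h, rootFunction γ s = -(γ t : ℂ) := fun γ => by
    have h1 : (⟨rePart (Complex.I ⊗ₜ[ℝ] (t : g)), by simp⟩ : h) = 0 := Subtype.ext (by simp)
    have h2 : (⟨imPart (Complex.I ⊗ₜ[ℝ] (t : g)), by simp⟩ : h) = t := Subtype.ext (by simp)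
    change Complex.I * ((γ ⟨rePart (Complex.I ⊗ₜ[ℝ] (t : g)), by simp⟩ : ℂ) +
      Complex.I * γ ⟨imPart (Complex.I ⊗ₜ[ℝ] (t : g)), by simp⟩) = _
    rw [h1, h2, map_zero, Complex.ofReal_zero, zero_add, ← mul_assoc, Complex.I_mul_I,
      neg_one_mul]
  -- With z = v + √-1 u this bracket is 2√-1 [u, v] = 2√-1 t.
  have h5 : ⁅z, conjPart z⁆ = (2 : ℂ) • (s : ℂ ⊗[ℝ] g) := by
    refine complexification_ext ?_ ?_
    · rw [rePart_lie, rePart_conjPart, imPart_conjPart, rePart_smul, hre, him]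
      simp [s]
    · rw [imPart_lie, rePart_conjPart, imPart_conjPart, imPart_smul, hre, him, lie_neg, lie_skew,
        huvt]
      simp [s, two_smul]
  have h6 : (2 : ℂ) • s ∈ corootSpace (weightOfRealRoot hα) := by
    rw [mem_corootSpace]
    refine Submodule.subset_span ⟨z, h4, conjPart z, ?_, h5⟩
    have := conjPart_mem_rootSpace h4
    rwa [rootFunction_neg] at this
  -- The scalar is fixed by requiring the root to take the value 2, since √-1 α takes the value
  -- -α(t) at s.
  have h7 : (-(2 / (α t : ℂ))) • s = IsKilling.coroot (weightOfRealRoot hα) := by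
    refine IsKilling.eq_coroot_of_mem_corootSpace_of_two _ ?_ ?_
    · have h8 : (-(2 / (α t : ℂ))) • s = (-(1 / (α t : ℂ))) • (2 : ℂ) • s := by
        rw [smul_smul]; congr 1; ring
      rw [h8]
      exact Submodule.smul_mem _ _ h6
    · have h8 : weightOfRealRoot hα ((-(2 / (α t : ℂ))) • s) =
          (-(2 / (α t : ℂ))) * weightOfRealRoot hα s :=
        map_smul (Weight.toLinear ℂ (complexCartan h) (ℂ ⊗[ℝ] g) (weightOfRealRoot hα)) _ _
      have h9 : weightOfRealRoot hα s = -(α t : ℂ) := hs α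
      rw [h8, h9]
      have : (α t : ℂ) ≠ 0 := Complex.ofReal_ne_zero.2 htpos.ne'
      field_simp
  have h8 : (IsKilling.reflectRoot (weightOfRealRoot hα) (weightOfRealRoot hβ) :
      complexCartan h → ℂ) = rootFunction (B.reflect α β) := by
    have h9 : weightOfRealRoot hβ (IsKilling.coroot (weightOfRealRoot hα)) =
        ((2 * β t / α t : ℝ) : ℂ) := by
      rw [← h7]
      have h10 : weightOfRealRoot hβ ((-(2 / (α t : ℂ))) • s) =
          (-(2 / (α t : ℂ))) * weightOfRealRoot hβ s :=
        map_smul (Weight.toLinear ℂ (complexCartan h) (ℂ ⊗[ℝ] g) (weightOfRealRoot hβ)) _ _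
      have h11 : weightOfRealRoot hβ s = -(β t : ℂ) := hs β
      rw [h10, h11]
      push_cast
      ring
    rw [reflect_apply, rootFunction_sub_smul, ← ht, ← h9]
    rfl
  rw [mem_realRoots_iff]
  refine ⟨fun h0 => hβ.1 ?_, ?_⟩
  · rw [← B.reflect_reflect hα.1 β, h0, map_zero]
  · rw [← h8]
    exact (IsKilling.reflectRoot (weightOfRealRoot hα) (weightOfRealRoot hβ)).genWeightSpace_ne_bot

theorem isReducedPositiveSystem [h.IsCartanSubalgebra] [IsKilling ℂ (ℂ ⊗[ℝ] g)]
    [(complexCartan h).IsCartanSubalgebra] (hP : IsPositiveSystem h P) :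
    B.IsReducedPositiveSystem P := by
  obtain ⟨x, -, hx⟩ := id hP
  refine ⟨⟨x, fun β hβ => ((hx β).1 hβ).2⟩, fun α hα β hβ => ?_, fun α hα β hβ c hc => ?_⟩
  · exact hP.mem_or_neg_mem (B.reflect_mem_realRoots ((hx α).1 hα).1 ((hx β).1 hβ).1)
  · refine (eq_or_eq_neg_of_smul ((hx α).1 hα).1 ((hx β).1 hβ).1 hc).resolve_left fun h1 => ?_
    have h2 := ((hx α).1 hα).2
    have h3 := ((hx β).1 hβ).2
    rw [h1, LinearMap.neg_apply] at h3
    linarith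

end InvariantInnerProduct

/-! ### The constant and the degree-lowering identity -/

namespace InvariantInnerProduct

variable {g : Type*} [LieRing g] [LieAlgebra ℝ g] [FiniteDimensional ℝ g]
  (B : InvariantInnerProduct g) {h : LieSubalgebra ℝ g} {P : Finset (Module.Dual ℝ h)}

theorem exists_laplacian_pow_weylD_sq (hP : B.IsReducedPositiveSystem P) :
    ∃ c : ℝ, c ≠ 0 ∧ ∀ {n : Type} [Fintype n] (f : Module.Basis n ℝ h),
      IsOrthonormalBasis (B.restrict h) f →
        (laplacian f ^ P.card) (B.weylD h P * B.weylD h P) =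
          algebraMap ℝ (SymmetricAlgebra ℝ h) (P.card.factorial * c) := by
  obtain ⟨k, hk, hD⟩ := hP.exists_weylD_eq
  have hhom : IsHomogeneousOfDegree P.card (B.rootProd P) := isHomogeneousOfDegree_prod _ _
  obtain ⟨f₀, hf₀⟩ := exists_isOrthonormalBasis (B.restrict h) (fun x y => B.symm x y)
    fun x hx => B.pos x fun h0 => hx (Subtype.ext h0)
  have hfac : (P.card.factorial : ℝ) ≠ 0 := Nat.cast_ne_zero.2 (Nat.factorial_ne_zero _)
  obtain ⟨c, hc, hceq⟩ := exists_laplacian_pow_sq f₀ hhom (hP.laplacian_rootProd hf₀)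
    hP.rootProd_ne_zero
  refine ⟨(P.card.factorial : ℝ)⁻¹ * (k * k * c),
    mul_ne_zero (inv_ne_zero hfac) (mul_ne_zero (mul_ne_zero hk hk) hc.ne'), ?_⟩
  intro n _ f hf
  -- All orthonormal bases give the same Laplacian, so one constant serves every f.
  have hff : laplacian f = laplacian f₀ := LinearMap.ext fun p => by
    rw [hf.laplacian_eq_frame (fun x y => B.symm x y) hf₀.sum_form_smul, laplacian_apply]
    simp only [hf₀.form_eq_coord]
  rw [hff, hD, smul_mul_smul_comm, map_smul, hceq, mul_inv_cancel_left₀ hfac, Algebra.smul_def,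
    ← map_mul]

/-- One factor D plays the harmonic multiplier of `laplacian_pow_mul`; the other is absorbed by the
radial part formula, which gives Δ^d(D P(p)) = aD. -/
theorem laplacian_pow_weylD_sq_mul_restriction (hP : B.IsReducedPositiveSystem P)
    {u v : Module.Dual ℝ h → g} (hF : B.IsRootFrame P u v) {m n : Type*} [Fintype m] [Fintype n]
    {e : Module.Basis m ℝ g} {f : Module.Basis n ℝ h} (he : IsOrthonormalBasis B.form e)
    (hf : IsOrthonormalBasis (B.restrict h) f) {d : ℕ} {p : SymmetricAlgebra ℝ g}
    (hp : IsHomogeneousOfDegree (2 * d) p) (hinv : IsInvariant p) {a : ℝ}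
    (ha : (laplacian e ^ d) p = algebraMap ℝ (SymmetricAlgebra ℝ g) a) :
    (laplacian f ^ (P.card + d)) (B.weylD h P * (B.weylD h P * B.restriction h p)) =
      ((P.card + d).choose P.card * a : ℝ) •
        (laplacian f ^ P.card) (B.weylD h P * B.weylD h P) := by
  obtain ⟨k, -, hD⟩ := hP.exists_weylD_eq
  have hhom : IsHomogeneousOfDegree P.card (B.rootProd P) := isHomogeneousOfDegree_prod _ _
  have h0 := hP.laplacian_rootProd hf
  have h1 : (laplacian f ^ d) (B.weylD h P * B.restriction h p) = a • B.weylD h P := by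
    rw [hD, smul_mul_assoc, map_smul,
      ← hF.rootProd_mul_restriction_laplacian_pow B he hf h0 d hinv, ha, AlgHom.commutes,
      mul_comm, ← Algebra.smul_def, smul_comm]
  rw [laplacian_pow_mul f (P.card + d) (k := P.card) (d := d), h1, mul_smul_comm, map_smul,
    smul_smul]
  · rw [hD]; exact hhom.smul k
  · rw [hD, map_smul, h0, smul_zero]
  · exact (show IsHomogeneousOfDegree P.card (B.weylD h P) by rw [hD]; exact hhom.smul k).mul
      (B.isHomogeneousOfDegree_restriction hp)
  · rfl

end InvariantInnerProduct

end CompactLie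

end

theorem mainTheorem4 {g : Type*} [LieRing g] [LieAlgebra ℝ g] [FiniteDimensional ℝ g]
    [LieAlgebra.IsSimple ℝ g] (B : CompactLie.InvariantInnerProduct g)
    (h : LieSubalgebra ℝ g) [h.IsCartanSubalgebra]
    (P : Finset (Module.Dual ℝ h)) (hP : CompactLie.IsPositiveSystem h P) :
    ∃ c : ℝ, c ≠ 0 ∧
      ∀ (m n : ℕ) (e : Module.Basis (Fin m) ℝ g) (f : Module.Basis (Fin n) ℝ h),
        CompactLie.IsOrthonormalBasis B.form e →
        CompactLie.IsOrthonormalBasis (B.restrict h) f →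
        (CompactLie.laplacian f ^ P.card) (B.weylD h P ^ 2) =
            algebraMap ℝ (SymmetricAlgebra ℝ h) (P.card.factorial * c) ∧
        ∀ (d : ℕ) (p : SymmetricAlgebra ℝ g),
          CompactLie.IsHomogeneousOfDegree (2 * d) p → CompactLie.IsInvariant p →
          ∃ a : ℝ,
            (CompactLie.laplacian e ^ d) p = algebraMap ℝ (SymmetricAlgebra ℝ g) a ∧
            (1 / ((d + P.card).factorial : ℝ)) •
                (CompactLie.laplacian f ^ (d + P.card)) (B.weylD h P ^ 2 * B.restriction h p) =
              algebraMap ℝ (SymmetricAlgebra ℝ h) (c / (d.factorial : ℝ) * a) := by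
  -- Simplicity enters through the trivial centre.
  have : LieAlgebra.IsKilling ℝ g := B.isKilling (LieAlgebra.center_eq_bot ℝ g)
  have : LieAlgebra.IsKilling ℂ (ℂ ⊗[ℝ] g) := CompactLie.isKilling_complexification
  have : IsLieAbelian h := LieAlgebra.IsKilling.instIsLieAbelianOfIsCartanSubalgebra ℝ g h
  have : (CompactLie.complexCartan h).IsCartanSubalgebra :=
    CompactLie.isCartanSubalgebra_complexCartan
  have hR := B.isReducedPositiveSystem hP
  obtain ⟨u, v, hF⟩ := B.exists_isRootFrame hP
  obtain ⟨c, hc, hD⟩ := B.exists_laplacian_pow_weylD_sq hR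
  refine ⟨c, hc, fun m n e f he hf => ⟨by rw [sq]; exact hD f hf, fun d p hp hinv => ?_⟩⟩
  obtain ⟨a, ha⟩ := CompactLie.isHomogeneousOfDegree_zero_iff.1
    (CompactLie.IsHomogeneousOfDegree.laplacian_pow e d (n := 0) (by rwa [zero_add]))
  refine ⟨a, ha.symm, ?_⟩
  rw [sq, mul_assoc, add_comm d,
    B.laplacian_pow_weylD_sq_mul_restriction hR hF he hf hp hinv ha.symm, hD f hf, smul_smul,
    Algebra.smul_def, ← map_mul]
  congr 1
  -- C(φ+d, φ) φ!/(φ+d)! = 1/d! matches the two normalizations.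
  have h1 : ((P.card + d).choose P.card : ℝ) * P.card.factorial * d.factorial =
      (P.card + d).factorial := by
    have := Nat.choose_mul_factorial_mul_factorial (Nat.le_add_right P.card d)
    rw [Nat.add_sub_cancel_left] at this
    exact_mod_cast this
  have h2 : (d.factorial : ℝ) ≠ 0 := Nat.cast_ne_zero.2 (Nat.factorial_ne_zero _)
  have h3 : ((P.card + d).factorial : ℝ) ≠ 0 := Nat.cast_ne_zero.2 (Nat.factorial_ne_zero _)
  field_simp
  linear_combination a * h1
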